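/- \textbf{Setting.} Let $X$ (states) and $U$ (actions) be measurable spaces with countably generated $\sigma$-algebras (e.g. standard Borel spaces), $T\in\mathbb N$ a horizon, $p_0$ a probability measure on $X$, $c_t:X\times U\to[0,\infty)$ ($t<T$) and $c_T:X\to[0,\infty)$ measurable costs, $\rho_t(du\mid x)$ reference policies and $\iota_t(dx'\mid x,u)$ system transition kernels (Markov kernels, $t<T$), $\lambda^P>0$ and $\lambda^S\in\mathbb R\setminus\{0\}$. A policy sequence $\pi=(\pi_t)_{t<T}$ and a sequence of transition kernels $\tau=(\tau_t)_{t<T}$ are sequences of Markov kernels $\pi_t(du\mid x)$, $\tau_t(dx'\mid x,u)$. Let $\mathbb D(\nu\|\mu)\in[0,\infty]$ be the Kullback--Leibler divergence ($+\infty$ if $\nu\not\ll\mu$), and $\mathcal R^\lambda_\mu[f]=-\frac1\lambda\log\mathbb E_\mu[e^{-\lambda f}]$ the entropic risk operator. Write $\operatorname{opt}^{\lambda}$ for the infimum if $\lambda>0$ and for the supremum if $\lambda<0$. For $0\le t\le T$ and a law $\mu$ of $x_t$, put $$J_t(\mu;\pi,\tau)=\mathbb E\Big[\sum_{k=t}^{T-1}c_k(x_k,u_k)+c_T(x_T)\Big]+\frac1{\lambda^P}\mathbb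 E\Big[\sum_{k=t}^{T-1}\mathbb D\big(\pi_k(\cdot|x_k)\|\rho_k(\cdot|x_k)\big)\Big]+\frac1{\lambda^S}K_t(\mu;\pi,\tau),$$ $$K_t(\mu;\pi,\tau)=\mathbb E\Big[\sum_{k=t}^{T-1}\mathbb D\big(\tau_k(\cdot|x_k,u_k)\|\iota_k(\cdot|x_k,u_k)\big)\Big],$$ where the expectation is over trajectories $(x_t,u_t,\dots,x_T)$ with $x_t\sim\mu$, $u_k\sim\pi_k(\cdot|x_k)$, $x_{k+1}\sim\tau_k(\cdot|x_k,u_k)$. Values are in $[-\infty,\infty]$ with $\infty-\infty:=-\infty$ (so for $\lambda^S<0$ only kernels with finite penalty matter in the maximization); the same convention is used for the one-stage functionals below. The central KL-regularized control problem is $\inf_\pi\operatorname{opt}^{\lambda^S}_\tau J_0(p_0;\pi,\tau)$. \textbf{Recursion.} Define $V_T=c_T$ and, for $t=T-1,\dots,0$, $$Q_t(x,u)=\mathcal R^{\lambda^S}_{\iota_t(\cdot|x,u)}[c_t(x,u)+V_{t+1}],\qquad V_t(x)=\mathcal R^{\lambda^P}_{\rho_t(\cdot|x)}[Q_t(x,\cdot)],$$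 $$\pi^*_t(du|x)=\rho_t(du|x)\,\frac{e^{-\lambda^PQ_t(x,u)}}{e^{-\lambda^PV_t(x)}},\qquad \tau^*_t(dx'|x,u)=\iota_t(dx'|x,u)\,\frac{e^{-\lambda^S(c_t(x,u)+V_{t+1}(x'))}}{e^{-\lambda^SQ_t(x,u)}}.$$ If $\lambda^S<0$, assume $\mathbb E_{\iota_t(\cdot|x,u)}[e^{-\lambda^S(c_t(x,u)+V_{t+1})}]<\infty$ for all $t<T$ and all $(x,u)$. \textbf{Theorem.} The functions $V_t,Q_t$ are measurable, real-valued and nonnegative, and $\pi^*_t,\tau^*_t$ are Markov kernels. Moreover: \begin{enumerate} \item For all $t<T$ and $x$, $V_t(x)=\min_{\nu}\{\mathbb E_\nu[Q_t(x,\cdot)]+\frac1{\lambda^P}\mathbb D(\nu\|\rho_t(\cdot|x))\}$ over probability measures $\nu$ on $U$, and $\pi^*_t(\cdot|x)$ is the unique minimizer. \item For all $t<T$ and $(x,u)$, $Q_t(x,u)=\operatorname{opt}^{\lambda^S}_{\nu}\{\mathbb E_\nu[c_t(x,u)+V_{t+1}]+\frac1{\lambda^S}\mathbb D(\nu\|\iota_t(\cdot|x,u))\}$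 over probability measures $\nu$ on $X$; no $\nu\ne\tau^*_t(\cdot|x,u)$ attains this value. If $\lambda^S>0$, or if $\mathbb D(\tau^*_t(\cdot|x,u)\|\iota_t(\cdot|x,u))<\infty$, then $\tau^*_t(\cdot|x,u)$ attains it, and $\tau^*_t(\cdot|x,u)$ is also the unique minimizer ($\lambda^S>0$) or maximizer ($\lambda^S<0$) of $\nu\mapsto\mathbb E_\nu[V_{t+1}]+\frac1{\lambda^S}\mathbb D(\nu\|\iota_t(\cdot|x,u))$. \item For all $t\le T$ and $x$, $V_t$ is the optimal cost-to-go: $V_t(x)=\inf_\pi\operatorname{opt}^{\lambda^S}_\tau J_t(\delta_x;\pi,\tau)$. The infimum is attained at $\pi^*$: $\operatorname{opt}^{\lambda^S}_\tau J_t(\delta_x;\pi^*,\tau)=V_t(x)$. If $\lambda^S>0$, or if $K_t(\delta_x;\pi^*,\tau^*)<\infty$, then $\tau^*$ attains the inner optimum: $J_t(\delta_x;\pi^*,\tau^*)=V_t(x)$. \item The central problem has optimal value $\mathbb E_{p_0}[V_0]\in[0,\infty]$, with outer infimum attained at $\pi^*$; if $\lambda^S>0$, or if $K_0(p_0;\pi^*,\tau^*)<\infty$,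 the inner optimum for $\pi^*$ is attained at $\tau^*$: $J_0(p_0;\pi^*,\tau^*)=\mathbb E_{p_0}[V_0]$. \end{enumerate} -/

import Mathlib

open MeasureTheory ProbabilityTheory InformationTheory
open scoped ENNReal

noncomputable section

/-- The entropic risk operator `R^λ_μ[f] = -(1/λ) log E_μ[exp(-λ f)]`. -/
def entropicRisk {α : Type*} [MeasurableSpace α] (lam : ℝ) (μ : Measure α) (f : α → ℝ) : ℝ :=
  -(1 / lam) * Real.log (∫ a, Real.exp (-lam * f a) ∂μ)

/-- The extremal value over a set of decisions: infimum if `λ > 0`, supremum otherwise. -/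
def optOver {α : Type*} (lam : ℝ) (S : Set α) (J : α → EReal) : EReal :=
  if 0 < lam then ⨅ q ∈ S, J q else ⨆ q ∈ S, J q

/-- `q` is a minimizer of `J` over `S` if `λ > 0`, and a maximizer otherwise. -/
def IsArgOpt {α : Type*} (lam : ℝ) (S : Set α) (J : α → EReal) (q : α) : Prop :=
  q ∈ S ∧ ∀ q' ∈ S, if 0 < lam then J q ≤ J q' else J q' ≤ J q

/-- The set of probability measures on `α`. -/
def probMeasures (α : Type*) [MeasurableSpace α] : Set (Measure α) :=
  {ν | IsProbabilityMeasure ν}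

/-- The one-stage functional `E_ν[f] + (1/λ) D(ν ‖ μ)` of a probability measure `ν`, for a
nonnegative measurable `f`, with values in the extended reals. Since `⊤ + ⊥ = ⊥`, for `λ < 0` it is
`-∞` whenever the divergence is infinite (in particular if `ν` is not absolutely continuous with
respect to `μ`), and for `λ > 0` it is `+∞` then. -/
def klStage {α : Type*} [MeasurableSpace α] (lam : ℝ) (μ : Measure α) (f : α → ℝ)
    (ν : Measure α) : EReal :=
  ((∫⁻ a, ENNReal.ofReal (f a) ∂ν : ℝ≥0∞) : EReal)
    + ((1 / lam : ℝ) : EReal) * ((klDiv ν μ : ℝ≥0∞) : EReal)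

/-- Trajectories `(x_0, u_0, …, u_{n-1}, x_n)` with `n` steps. -/
abbrev Trajectory (X U : Type*) (n : ℕ) : Type _ := (Fin (n + 1) → X) × (Fin n → U)

/-- Prepend a state and an action to a trajectory. -/
def Trajectory.cons {X U : Type*} {n : ℕ} (p : X × U × Trajectory X U n) :
    Trajectory X U (n + 1) :=
  (Fin.cons p.1 p.2.2.1, Fin.cons p.2.1 p.2.2.2)

theorem Trajectory.measurable_cons {X U : Type*} [MeasurableSpace X] [MeasurableSpace U] {n : ℕ} :
    Measurable (Trajectory.cons : X × U × Trajectory X U n → Trajectory X U (n + 1)) := by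
  refine Measurable.prodMk ?_ ?_
  · refine measurable_pi_lambda _ fun i => ?_
    refine Fin.cases ?_ (fun j => ?_) i
    · simpa [Trajectory.cons] using measurable_fst
    · simp only [Fin.cons_succ]
      fun_prop
  · refine measurable_pi_lambda _ fun i => ?_
    refine Fin.cases ?_ (fun j => ?_) i
    · simp only [Fin.cons_zero]
      fun_prop
    · simp only [Fin.cons_succ]
      fun_prop

/-- The conditional law, given the state at time `t`, of the trajectory of the next `n` steps when
at each time `k` the action is drawn from `π k` and the next state from `τ k`. -/
def trajKernel {X U : Type*} [MeasurableSpace X] [MeasurableSpace U]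
    (π : ℕ → Kernel X U) (τ : ℕ → Kernel (X × U) X) :
    (n : ℕ) → (t : ℕ) → Kernel X (Trajectory X U n)
  | 0, _ => Kernel.deterministic (fun x => (fun _ => x, Fin.elim0)) (by fun_prop)
  | n + 1, t =>
    (Kernel.id ×ₖ (π t ⊗ₖ (trajKernel π τ n (t + 1) ∘ₖ τ t))).map Trajectory.cons

/-- The data of the central KL-regularized control problem: horizon, law of the initial state,
nonnegative running and terminal costs, reference policies `ρ`, system transition kernels `ι`, and
the two regularization weights. Sequences are indexed by `ℕ`; only times `t < T` are used. -/
structure KLControl (X U : Type*) [MeasurableSpace X] [MeasurableSpace U] where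
  T : ℕ
  init : Measure X
  init_prob : IsProbabilityMeasure init
  c : ℕ → X × U → ℝ
  c_measurable : ∀ t, Measurable (c t)
  c_nonneg : ∀ t z, 0 ≤ c t z
  cT : X → ℝ
  cT_measurable : Measurable cT
  cT_nonneg : ∀ x, 0 ≤ cT x
  ρ : ℕ → Kernel X U
  ρ_markov : ∀ t, IsMarkovKernel (ρ t)
  ι : ℕ → Kernel (X × U) X
  ι_markov : ∀ t, IsMarkovKernel (ι t)
  lamP : ℝ
  lamP_pos : 0 < lamP
  lamS : ℝ
  lamS_ne_zero : lamS ≠ 0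

namespace KLControl

attribute [instance] KLControl.init_prob KLControl.ρ_markov KLControl.ι_markov

variable {X U : Type*} [MeasurableSpace X] [MeasurableSpace U] (P : KLControl X U)

/-- Admissible policy sequences. -/
def policies : Set (ℕ → Kernel X U) := {π | ∀ t < P.T, IsMarkovKernel (π t)}

/-- Admissible sequences of transition kernels. -/
def transitions : Set (ℕ → Kernel (X × U) X) := {τ | ∀ t < P.T, IsMarkovKernel (τ t)}

/-- The law of the trajectory from time `t` to the horizon when the state at time `t` has
law `μ`. -/
def law (π : ℕ → Kernel X U) (τ : ℕ → Kernel (X × U) X) (t : ℕ) (μ : Measure X) :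
    Measure (Trajectory X U (P.T - t)) :=
  μ.bind (trajKernel π τ (P.T - t) t)

/-- Cumulative cost of a trajectory that starts at time `t`. -/
def cumCost (t : ℕ) (ξ : Trajectory X U (P.T - t)) : ℝ≥0∞ :=
  (∑ k : Fin (P.T - t), ENNReal.ofReal (P.c (t + k) (ξ.1 k.castSucc, ξ.2 k)))
    + ENNReal.ofReal (P.cT (ξ.1 (Fin.last _)))

/-- `∑ₖ D(π_k(·|x_k) ‖ ρ_k(·|x_k))` along a trajectory that starts at time `t`. -/
def policyKL (π : ℕ → Kernel X U) (t : ℕ) (ξ : Trajectory X U (P.T - t)) : ℝ≥0∞ :=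
  ∑ k : Fin (P.T - t), klDiv (π (t + k) (ξ.1 k.castSucc)) (P.ρ (t + k) (ξ.1 k.castSucc))

/-- `∑ₖ D(τ_k(·|x_k,u_k) ‖ ι_k(·|x_k,u_k))` along a trajectory that starts at time `t`. -/
def transitionKL (τ : ℕ → Kernel (X × U) X) (t : ℕ) (ξ : Trajectory X U (P.T - t)) : ℝ≥0∞ :=
  ∑ k : Fin (P.T - t),
    klDiv (τ (t + k) (ξ.1 k.castSucc, ξ.2 k)) (P.ι (t + k) (ξ.1 k.castSucc, ξ.2 k))

/-- The expected transition penalty (not yet multiplied by `1/λ^S`). -/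
def expTransitionKL (t : ℕ) (μ : Measure X) (π : ℕ → Kernel X U) (τ : ℕ → Kernel (X × U) X) :
    ℝ≥0∞ :=
  ∫⁻ ξ, P.transitionKL τ t ξ ∂(P.law π τ t μ)

/-- The objective from time `t` on, with law `μ` of the state at time `t`: expected cumulative cost
plus `(1/λ^P)` times the policy penalty plus `(1/λ^S)` times the transition penalty. Since
`⊤ + ⊥ = ⊥`, for `λ^S < 0` the objective is `-∞` when the expected transition penalty is infinite,
so the maximization over `τ` is effectively over those with finite penalty. -/
def objective (t : ℕ) (μ : Measure X) (π : ℕ → Kernel X U) (τ : ℕ → Kernel (X × U) X) : EReal :=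
  ((∫⁻ ξ, P.cumCost t ξ ∂(P.law π τ t μ) : ℝ≥0∞) : EReal)
    + ((1 / P.lamP : ℝ) : EReal) * ((∫⁻ ξ, P.policyKL π t ξ ∂(P.law π τ t μ) : ℝ≥0∞) : EReal)
    + ((1 / P.lamS : ℝ) : EReal) * ((P.expTransitionKL t μ π τ : ℝ≥0∞) : EReal)

/-- The inner problem: `opt^{λ^S}` over transition kernels, for a given policy sequence. -/
def innerValue (t : ℕ) (μ : Measure X) (π : ℕ → Kernel X U) : EReal :=
  optOver P.lamS P.transitions (fun τ => P.objective t μ π τ)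

/-- The optimal value `min_π opt^{λ^S}_τ` of the problem from time `t` on. -/
def optimalValue (t : ℕ) (μ : Measure X) : EReal :=
  ⨅ π ∈ P.policies, P.innerValue t μ π

/-- The backward recursion, by the number of remaining steps. -/
def valueAux : ℕ → ℕ → X → ℝ
  | 0, _, x => P.cT x
  | n + 1, t, x =>
    entropicRisk P.lamP (P.ρ t x) fun u =>
      entropicRisk P.lamS (P.ι t (x, u)) fun x' => P.c t (x, u) + valueAux n (t + 1) x'

/-- The function `V_t` of the backward recursion, for `t ≤ T`. -/
def V (t : ℕ) (x : X) : ℝ := P.valueAux (P.T - t) t x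

/-- The function `Q_t` of the backward recursion, for `t < T`. -/
def Q (t : ℕ) (z : X × U) : ℝ :=
  entropicRisk P.lamS (P.ι t z) fun x' => P.c t z + P.V (t + 1) x'

/-- The tilted policies `π*_t = ρ_t exp(-λ^P Q_t) / exp(-λ^P V_t)`. -/
def optPolicy (t : ℕ) : Kernel X U :=
  (P.ρ t).withDensity fun x u =>
    ENNReal.ofReal (Real.exp (-P.lamP * P.Q t (x, u)) / Real.exp (-P.lamP * P.V t x))

/-- The tilted kernels `τ*_t = ι_t exp(-λ^S (c_t + V_{t+1})) / exp(-λ^S Q_t)`. -/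
def optTransition (t : ℕ) : Kernel (X × U) X :=
  (P.ι t).withDensity fun z x' =>
    ENNReal.ofReal
      (Real.exp (-P.lamS * (P.c t z + P.V (t + 1) x')) / Real.exp (-P.lamS * P.Q t z))

end KLControl

end

/-!
Tilting `μ` by `exp(-λ f)` turns the one-stage functional into an exact identity: `E_ν[f]` plus
`(1/λ) D(ν ‖ μ)` equals the entropic risk of `f` plus `(1/λ)` times the divergence of `ν` from the
Gibbs measure. Applied to both steps of every stage and summed along a trajectory, this writes the
objective as `∫ V_t dμ` plus `1/λ^P` times the expected divergence of `π` from `π*` plus `1/λ^S`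
times that of `τ` from `τ*`, and the optimality of the pair is the nonnegativity of the two gaps.

For `λ^S < 0` the kernels `τ*` may have infinite penalty, so that the identity becomes `∞ - ∞` and
they need not attain the supremum. Truncating the costs at `m` makes the tilted kernels of the
truncated problem admissible with finite penalty; against any policy they secure at least
`∫ V_t^m dμ`, and this converges to `∫ V_t dμ` by dominated convergence in the recursion and
Fatou's lemma.
-/

noncomputable section

section GibbsVariational

variable {α : Type*} [MeasurableSpace α]

theorem integrable_min_llr_zero {μ ν : Measure α} [IsFiniteMeasure μ] [IsFiniteMeasure ν]
    (hνμ : ν ≪ μ) : Integrable (fun a => min (llr ν μ a) 0) ν := by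
  rw [← integrable_rnDeriv_smul_iff hνμ]
  have hbound (r : ℝ) (hr : 0 ≤ r) : r * min (Real.log r) 0 ∈ Set.Icc (-1) 0 := by
    refine ⟨?_, mul_nonpos_of_nonneg_of_nonpos hr (min_le_right _ _)⟩
    rw [mul_min_of_nonneg _ _ hr, mul_zero, le_min_iff]
    have := klFun_nonneg hr
    rw [klFun_apply] at this
    exact ⟨by linarith, by norm_num⟩
  refine Integrable.of_mem_Icc (-1) 0 ?_ (.of_forall fun a => hbound _ ENNReal.toReal_nonneg)
  have := measurable_llr ν μ
  fun_prop

theorem integrable_exp_neg {μ : Measure α} [IsFiniteMeasure μ] {g : α → ℝ} (hg : Measurable g)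
    (hg0 : ∀ a, 0 ≤ g a) : Integrable (fun a => Real.exp (-g a)) μ :=
  .of_mem_Icc 0 1 (by fun_prop) (.of_forall fun a =>
    ⟨(Real.exp_pos _).le, Real.exp_le_one_iff.2 (neg_nonpos.2 (hg0 a))⟩)

theorem integral_exp_neg_le_one {μ : Measure α} [IsProbabilityMeasure μ] {g : α → ℝ}
    (hg0 : ∀ a, 0 ≤ g a) : ∫ a, Real.exp (-g a) ∂μ ≤ 1 := by
  by_cases hi : Integrable (fun a => Real.exp (-g a)) μ
  · calc ∫ a, Real.exp (-g a) ∂μ ≤ ∫ _, (1 : ℝ) ∂μ :=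
          integral_mono hi (integrable_const _) fun a => by simpa using hg0 a
      _ = 1 := by simp
  · simp [integral_undef hi]

/-- The two summands of `llr ν μ + g` cannot cancel, because the negative part of `llr ν μ` is
integrable and `g` is nonnegative. -/
theorem integrable_llr_tilted_neg_iff {μ ν : Measure α} [IsFiniteMeasure μ] [IsFiniteMeasure ν]
    (hνμ : ν ≪ μ) {g : α → ℝ} (hg : Measurable g) (hg0 : ∀ a, 0 ≤ g a) :
    Integrable (llr ν (μ.tilted fun a => -g a)) ν ↔ Integrable (llr ν μ) ν ∧ Integrable g ν := by
  have hexp : Integrable (fun a => Real.exp (-g a)) μ := integrable_exp_neg hg hg0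
  refine ⟨fun h => ?_, fun ⟨hllr, hgν⟩ => integrable_llr_tilted_right hνμ hgν.neg hllr hexp⟩
  have hsum : Integrable (fun a => llr ν μ a + g a) ν := by
    have h' := (h.congr (llr_tilted_right hνμ hexp)).sub
      (integrable_const (Real.log (∫ a, Real.exp (-g a) ∂μ)))
    refine h'.congr (.of_forall fun a => ?_)
    simp only [Pi.sub_apply]
    ring
  have hllr : Integrable (llr ν μ) ν :=
    integrable_of_le_of_le (measurable_llr ν μ).aestronglyMeasurable
      (.of_forall fun a => min_le_left _ _) (.of_forall fun a => le_add_of_nonneg_right (hg0 a))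
      (integrable_min_llr_zero hνμ) hsum
  exact ⟨hllr, (hsum.sub hllr).congr (.of_forall fun a => add_sub_cancel_left _ _)⟩

theorem klDiv_eq_ofReal_integral_llr {μ ν : Measure α} [IsProbabilityMeasure μ]
    [IsProbabilityMeasure ν] (hνμ : ν ≪ μ) (hi : Integrable (llr ν μ) ν) :
    klDiv ν μ = ENNReal.ofReal (∫ a, llr ν μ a ∂ν) := by
  simp [klDiv_of_ac_of_integrable hνμ hi]

theorem integral_llr_nonneg {μ ν : Measure α} [IsProbabilityMeasure μ]
    [IsProbabilityMeasure ν] (hνμ : ν ≪ μ) (hi : Integrable (llr ν μ) ν) :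
    0 ≤ ∫ a, llr ν μ a ∂ν := by
  simpa using integral_llr_add_sub_measure_univ_nonneg hνμ hi

theorem klDiv_tilted_neg_ne_top_iff {μ ν : Measure α} [IsFiniteMeasure μ] [IsFiniteMeasure ν]
    {g : α → ℝ} (hg : Measurable g) (hg0 : ∀ a, 0 ≤ g a) :
    klDiv ν (μ.tilted fun a => -g a) ≠ ⊤ ↔
      klDiv ν μ ≠ ⊤ ∧ ∫⁻ a, ENNReal.ofReal (g a) ∂ν ≠ ⊤ := by
  have hac : ν ≪ μ.tilted (fun a => -g a) ↔ ν ≪ μ :=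
    ⟨fun h => h.trans (tilted_absolutelyContinuous _ _),
      fun h => h.trans (absolutelyContinuous_tilted (integrable_exp_neg hg hg0))⟩
  rw [klDiv_ne_top_iff, klDiv_ne_top_iff, hac,
    lintegral_ofReal_ne_top_iff_integrable hg.aestronglyMeasurable (.of_forall hg0), and_assoc]
  exact and_congr_right fun hνμ => integrable_llr_tilted_neg_iff hνμ hg hg0

theorem klDiv_tilted_neg_add {μ ν : Measure α} [IsProbabilityMeasure μ] [IsProbabilityMeasure ν]
    {g : α → ℝ} (hg : Measurable g) (hg0 : ∀ a, 0 ≤ g a) :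
    klDiv ν (μ.tilted fun a => -g a) + ENNReal.ofReal (-Real.log (∫ a, Real.exp (-g a) ∂μ))
      = klDiv ν μ + ∫⁻ a, ENNReal.ofReal (g a) ∂ν := by
  have hexp : Integrable (fun a => Real.exp (-g a)) μ := integrable_exp_neg hg hg0
  have := isProbabilityMeasure_tilted hexp
  have hfin := klDiv_tilted_neg_ne_top_iff (μ := μ) (ν := ν) hg hg0
  by_cases h : klDiv ν (μ.tilted fun a => -g a) = ⊤
  · rw [h, top_add, eq_comm, ENNReal.add_eq_top]
    by_contra! hne
    exact hfin.2 hne h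
  obtain ⟨hkl, hgν⟩ := hfin.1 h
  obtain ⟨hνμ, hllr⟩ := klDiv_ne_top_iff.1 hkl
  obtain ⟨hνt, hllrt⟩ := klDiv_ne_top_iff.1 h
  have hgi : Integrable g ν :=
    (lintegral_ofReal_ne_top_iff_integrable hg.aestronglyMeasurable (.of_forall hg0)).1 hgν
  have hlogZ : 0 ≤ -Real.log (∫ a, Real.exp (-g a) ∂μ) :=
    neg_nonneg.2 (Real.log_nonpos (integral_exp_pos hexp).le (integral_exp_neg_le_one hg0))
  have hint : ∫ a, llr ν (μ.tilted fun a => -g a) a ∂ν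
      = ∫ a, llr ν μ a ∂ν - ∫ a, -g a ∂ν + Real.log (∫ a, Real.exp (-g a) ∂μ) :=
    integral_llr_tilted_right hνμ hgi.neg hexp hllr
  rw [klDiv_eq_ofReal_integral_llr hνt hllrt, klDiv_eq_ofReal_integral_llr hνμ hllr,
    ← ofReal_integral_eq_lintegral_ofReal hgi (.of_forall hg0),
    ← ENNReal.ofReal_add (integral_llr_nonneg hνt hllrt) hlogZ,
    ← ENNReal.ofReal_add (integral_llr_nonneg hνμ hllr) (integral_nonneg hg0), hint,
    integral_neg]
  ring_nf

theorem klDiv_tilted_add_lintegral {μ ν : Measure α} [IsProbabilityMeasure μ]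
    [IsProbabilityMeasure ν] {g : α → ℝ} (hg : Measurable g) (hg0 : ∀ a, 0 ≤ g a)
    (hexp : Integrable (fun a => Real.exp (g a)) μ) :
    klDiv ν (μ.tilted g) + ∫⁻ a, ENNReal.ofReal (g a) ∂ν
      = klDiv ν μ + ENNReal.ofReal (Real.log (∫ a, Real.exp (g a) ∂μ)) := by
  have := isProbabilityMeasure_tilted hexp
  have hZ : ∫ a, Real.exp (-g a) ∂(μ.tilted g) = (∫ a, Real.exp (g a) ∂μ)⁻¹ := by
    simpa using integral_exp_tilted (μ := μ) g (-g)
  have h := klDiv_tilted_neg_add (μ := μ.tilted g) (ν := ν) hg hg0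
  rw [hZ, Real.log_inv, neg_neg, show (μ.tilted g).tilted (fun a => -g a) = μ from
    tilted_neg_same hexp] at h
  exact h.symm

theorem klDiv_tilted_self_le {μ : Measure α} [IsProbabilityMeasure μ] {g : α → ℝ}
    (hg : Measurable g) (hg0 : ∀ a, 0 ≤ g a) {C : ℝ} (hgC : ∀ a, g a ≤ C) :
    klDiv (μ.tilted g) μ ≤ ENNReal.ofReal C := by
  have hexp : Integrable (fun a => Real.exp (g a)) μ :=
    .of_mem_Icc 0 (Real.exp C) (by fun_prop)
      (.of_forall fun a => ⟨(Real.exp_pos _).le, Real.exp_le_exp.2 (hgC a)⟩)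
  have := isProbabilityMeasure_tilted hexp
  have h := klDiv_tilted_add_lintegral (ν := μ.tilted g) hg hg0 hexp
  rw [klDiv_self, zero_add] at h
  calc klDiv (μ.tilted g) μ
      ≤ ∫⁻ a, ENNReal.ofReal (g a) ∂(μ.tilted g) := h ▸ le_self_add
    _ ≤ ∫⁻ _, ENNReal.ofReal C ∂(μ.tilted g) :=
        lintegral_mono fun a => ENNReal.ofReal_le_ofReal (hgC a)
    _ = ENNReal.ofReal C := by simp

end GibbsVariational

section EntropicRisk

variable {α : Type*} [MeasurableSpace α] {μ ν : Measure α} {lam : ℝ} {f g : α → ℝ}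

/-- The Gibbs measure `dν ∝ exp(-λ f) dμ`, which attains the optimum in the variational formula
for `entropicRisk lam μ f`. -/
abbrev gibbsMeasure (lam : ℝ) (μ : Measure α) (f : α → ℝ) : Measure α :=
  μ.tilted fun a => -lam * f a

theorem gibbsMeasure_const_add (lam : ℝ) (μ : Measure α) (c : ℝ) (f : α → ℝ) :
    gibbsMeasure lam μ (fun a => c + f a) = gibbsMeasure lam μ f := by
  unfold gibbsMeasure Measure.tilted
  congr 1
  funext a
  simp only [mul_add, Real.exp_add]
  rw [integral_const_mul, mul_div_mul_left _ _ (Real.exp_pos _).ne']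

theorem exp_neg_mul_le_one_add_of_le {lam x y : ℝ} (hx : 0 ≤ x) (hxy : x ≤ y) :
    Real.exp (-lam * x) ≤ 1 + Real.exp (-lam * y) := by
  rcases le_total 0 lam with hl | hl
  · have : Real.exp (-lam * x) ≤ 1 := Real.exp_le_one_iff.2 (by nlinarith)
    linarith [Real.exp_pos (-lam * y)]
  · have : Real.exp (-lam * x) ≤ Real.exp (-lam * y) := Real.exp_le_exp.2 (by nlinarith)
    linarith

theorem integrable_exp_neg_mul_of_le [IsFiniteMeasure μ] (hf : Measurable f)
    (hf0 : ∀ a, 0 ≤ f a) (hfg : ∀ a, f a ≤ g a)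
    (hg : Integrable (fun a => Real.exp (-lam * g a)) μ) :
    Integrable (fun a => Real.exp (-lam * f a)) μ :=
  integrable_of_le_of_le (by fun_prop) (.of_forall fun _ => (Real.exp_pos _).le)
    (.of_forall fun a => exp_neg_mul_le_one_add_of_le (hf0 a) (hfg a)) (integrable_zero _ _ _)
    ((integrable_const 1).add hg)

theorem integrable_exp_neg_mul_of_pos [IsFiniteMeasure μ] (hl : 0 < lam) (hf : Measurable f)
    (hf0 : ∀ a, 0 ≤ f a) : Integrable (fun a => Real.exp (-lam * f a)) μ := by
  simpa only [neg_mul] using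
    integrable_exp_neg (hf.const_mul lam) fun a => mul_nonneg hl.le (hf0 a)

theorem entropicRisk_nonneg [IsProbabilityMeasure μ] (hf0 : ∀ a, 0 ≤ f a) :
    0 ≤ entropicRisk lam μ f := by
  unfold entropicRisk
  rcases le_or_gt lam 0 with hl | hl
  · refine mul_nonneg (by simpa using hl) ?_
    by_cases hi : Integrable (fun a => Real.exp (-lam * f a)) μ
    · refine Real.log_nonneg ?_
      calc (1 : ℝ) = ∫ _, (1 : ℝ) ∂μ := by simp
        _ ≤ _ := integral_mono (integrable_const _) hi fun a => by
          simpa using mul_nonpos_of_nonpos_of_nonneg hl (hf0 a)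
    · rw [integral_undef hi, Real.log_zero]
  · refine mul_nonneg_of_nonpos_of_nonpos (by simpa using hl.le) ?_
    have := integral_exp_neg_le_one (μ := μ) (g := fun a => lam * f a)
      fun a => mul_nonneg hl.le (hf0 a)
    exact Real.log_nonpos (integral_nonneg fun a => (Real.exp_pos _).le) (by simpa using this)

theorem entropicRisk_mono [IsFiniteMeasure μ] [NeZero μ] (hf : Measurable f)
    (hf0 : ∀ a, 0 ≤ f a) (hfg : ∀ a, f a ≤ g a)
    (hgi : Integrable (fun a => Real.exp (-lam * g a)) μ) :
    entropicRisk lam μ f ≤ entropicRisk lam μ g := by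
  have hfi : Integrable (fun a => Real.exp (-lam * f a)) μ :=
    integrable_exp_neg_mul_of_le hf hf0 hfg hgi
  unfold entropicRisk
  rcases le_total lam 0 with hl | hl
  · refine mul_le_mul_of_nonneg_left (Real.log_le_log (integral_exp_pos hfi)
      (integral_mono hfi hgi fun a => ?_)) (by simpa using hl)
    exact Real.exp_le_exp.2 (mul_le_mul_of_nonneg_left (hfg a) (neg_nonneg.2 hl))
  · refine mul_le_mul_of_nonpos_left (Real.log_le_log (integral_exp_pos hgi)
      (integral_mono hgi hfi fun a => ?_)) (by simpa using hl)
    exact Real.exp_le_exp.2 (mul_le_mul_of_nonpos_left (hfg a) (neg_nonpos.2 hl))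

theorem entropicRisk_const [IsProbabilityMeasure μ] (hl : lam ≠ 0) (c : ℝ) :
    entropicRisk lam μ (fun _ => c) = c := by
  simp [entropicRisk, hl]

theorem entropicRisk_le_of_le [IsProbabilityMeasure μ] (hl : lam ≠ 0) (hf : Measurable f)
    (hf0 : ∀ a, 0 ≤ f a) {c : ℝ} (hfc : ∀ a, f a ≤ c) : entropicRisk lam μ f ≤ c :=
  (entropicRisk_mono hf hf0 hfc (integrable_const _)).trans_eq (entropicRisk_const hl c)

theorem tendsto_entropicRisk [IsFiniteMeasure μ] [NeZero μ] {F : ℕ → α → ℝ}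
    (hF : ∀ m, Measurable (F m)) (hF0 : ∀ m a, 0 ≤ F m a) (hFf : ∀ m a, F m a ≤ f a)
    (hf : Integrable (fun a => Real.exp (-lam * f a)) μ)
    (hlim : ∀ a, Filter.Tendsto (fun m => F m a) Filter.atTop (nhds (f a))) :
    Filter.Tendsto (fun m => entropicRisk lam μ (F m)) Filter.atTop
      (nhds (entropicRisk lam μ f)) := by
  refine Filter.Tendsto.const_mul _ (Filter.Tendsto.log ?_ (integral_exp_pos hf).ne')
  refine tendsto_integral_of_dominated_convergence (fun a => 1 + Real.exp (-lam * f a))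
    (fun m => ?_) ((integrable_const 1).add hf) (fun m => .of_forall fun a => ?_)
    (.of_forall fun a => ((hlim a).const_mul _).rexp)
  · have := hF m
    fun_prop
  · rw [Real.norm_of_nonneg (Real.exp_pos _).le]
    exact exp_neg_mul_le_one_add_of_le (hF0 m a) (hFf m a)

theorem exp_neg_mul_entropicRisk [NeZero μ] (hl : lam ≠ 0)
    (hi : Integrable (fun a => Real.exp (-lam * f a)) μ) :
    Real.exp (-lam * entropicRisk lam μ f) = ∫ a, Real.exp (-lam * f a) ∂μ := by
  unfold entropicRisk
  rw [← mul_assoc, show -lam * -(1 / lam) = 1 by field_simp, one_mul,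
    Real.exp_log (integral_exp_pos hi)]

theorem gibbsMeasure_eq_withDensity [NeZero μ] (hl : lam ≠ 0)
    (hi : Integrable (fun a => Real.exp (-lam * f a)) μ) :
    gibbsMeasure lam μ f = μ.withDensity fun a =>
      ENNReal.ofReal (Real.exp (-lam * f a) / Real.exp (-lam * entropicRisk lam μ f)) := by
  rw [exp_neg_mul_entropicRisk hl hi]
  rfl

theorem lintegral_add_klDiv_eq_of_pos [IsProbabilityMeasure μ] [IsProbabilityMeasure ν]
    (hl : 0 < lam) (hf : Measurable f) (hf0 : ∀ a, 0 ≤ f a) :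
    ∫⁻ a, ENNReal.ofReal (f a) ∂ν + ENNReal.ofReal (1 / lam) * klDiv ν μ
      = ENNReal.ofReal (entropicRisk lam μ f)
        + ENNReal.ofReal (1 / lam) * klDiv ν (gibbsMeasure lam μ f) := by
  have h := congrArg (fun y => ENNReal.ofReal (1 / lam) * y)
    (klDiv_tilted_neg_add (μ := μ) (ν := ν) (hf.const_mul lam) fun a => mul_nonneg hl.le (hf0 a))
  simp only [mul_add, neg_mul_eq_neg_mul] at h
  rw [← ENNReal.ofReal_mul (by positivity), ← lintegral_const_mul _ (by fun_prop)] at h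
  simp only [← ENNReal.ofReal_mul (show 0 ≤ 1 / lam by positivity), ← mul_assoc,
    one_div_mul_cancel hl.ne', one_mul] at h
  rw [add_comm, ← h, add_comm, entropicRisk, mul_neg, neg_mul]

theorem lintegral_add_klDiv_eq_of_neg [IsProbabilityMeasure μ] [IsProbabilityMeasure ν]
    (hl : lam < 0) (hf : Measurable f) (hf0 : ∀ a, 0 ≤ f a)
    (hi : Integrable (fun a => Real.exp (-lam * f a)) μ) :
    ∫⁻ a, ENNReal.ofReal (f a) ∂ν
        + ENNReal.ofReal (-(1 / lam)) * klDiv ν (gibbsMeasure lam μ f)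
      = ENNReal.ofReal (entropicRisk lam μ f) + ENNReal.ofReal (-(1 / lam)) * klDiv ν μ := by
  have hw : 0 ≤ -(1 / lam) := neg_nonneg.2 (one_div_neg.2 hl).le
  have h := congrArg (fun y => ENNReal.ofReal (-(1 / lam)) * y)
    (klDiv_tilted_add_lintegral (ν := ν) (hf.const_mul (-lam))
      (fun a => mul_nonneg (neg_nonneg.2 hl.le) (hf0 a)) hi)
  simp only [mul_add] at h
  rw [← ENNReal.ofReal_mul hw, ← lintegral_const_mul _ (by fun_prop)] at h
  have hcancel : -(1 / lam) * -lam = 1 := by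
    have := hl.ne
    field_simp
  simp only [← ENNReal.ofReal_mul hw, ← mul_assoc, hcancel, one_mul] at h
  rw [add_comm, h, add_comm, entropicRisk]

theorem klDiv_gibbsMeasure_self_le_of_neg [IsProbabilityMeasure μ] (hl : lam < 0)
    (hf : Measurable f) (hf0 : ∀ a, 0 ≤ f a) {c : ℝ} (hfc : ∀ a, f a ≤ c) :
    klDiv (gibbsMeasure lam μ f) μ ≤ ENNReal.ofReal (-lam * c) :=
  klDiv_tilted_self_le (hf.const_mul (-lam))
    (fun a => mul_nonneg (neg_nonneg.2 hl.le) (hf0 a))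
    fun a => mul_le_mul_of_nonneg_left (hfc a) (neg_nonneg.2 hl.le)

end EntropicRisk

section Kernels

variable {α β : Type*} [MeasurableSpace α] [MeasurableSpace β]

theorem measurable_entropicRisk {κ : Kernel α β} [IsSFiniteKernel κ] {f : α × β → ℝ}
    (hf : Measurable f) (lam : ℝ) :
    Measurable fun a => entropicRisk lam (κ a) fun b => f (a, b) := by
  unfold entropicRisk
  have : Measurable fun a => ∫ b, Real.exp (-lam * f (a, b)) ∂κ a :=
    (StronglyMeasurable.integral_kernel_prod_right' (f := fun p => Real.exp (-lam * f p))
      (Measurable.stronglyMeasurable (by fun_prop))).measurable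
  fun_prop

theorem withDensity_entropicRisk_apply {κ : Kernel α β} [IsMarkovKernel κ] {f : α × β → ℝ}
    (hf : Measurable f) {lam : ℝ} (hl : lam ≠ 0) {a : α}
    (hi : Integrable (fun b => Real.exp (-lam * f (a, b))) (κ a)) :
    κ.withDensity (fun a b => ENNReal.ofReal (Real.exp (-lam * f (a, b))
      / Real.exp (-lam * entropicRisk lam (κ a) fun b => f (a, b)))) a
      = gibbsMeasure lam (κ a) fun b => f (a, b) := by
  have hrisk : Measurable fun p : α × β => entropicRisk lam (κ p.1) fun b => f (p.1, b) :=
    (measurable_entropicRisk hf lam).comp measurable_fst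
  rw [Kernel.withDensity_apply _ (by unfold Function.uncurry; fun_prop),
    gibbsMeasure_eq_withDensity hl hi]

open Classical in
theorem measurable_klDiv_kernel [MeasurableSpace.CountableOrCountablyGenerated α β]
    (κ η : Kernel α β) [IsFiniteKernel κ] [IsFiniteKernel η] :
    Measurable fun a => klDiv (κ a) (η a) := by
  have hdensity (a : α) : klDiv (κ a) (η a) = if κ a ≪ η a then
      ∫⁻ b, ENNReal.ofReal (klFun (Kernel.rnDeriv κ η a b).toReal) ∂(η a) else ∞ := by
    rw [klDiv_eq_lintegral_klFun]
    congr 1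
    refine lintegral_congr_ae ?_
    filter_upwards [Kernel.rnDeriv_eq_rnDeriv_measure (κ := κ) (η := η) (a := a)] with b hb
    rw [hb]
  simp only [hdensity]
  refine Measurable.ite (Kernel.measurableSet_absolutelyContinuous κ η) ?_ measurable_const
  have hrn : Measurable fun p : α × β => Kernel.rnDeriv κ η p.1 p.2 :=
    Kernel.measurable_rnDeriv κ η
  exact Measurable.lintegral_kernel_prod_right
    (measurable_klFun.comp hrn.ennreal_toReal).ennreal_ofReal

end Kernels

section ERealPenalty

variable {A B K : ℝ≥0∞} {r : ℝ}

theorem coe_ennreal_ofReal_of_nonneg {x : ℝ} (hx : 0 ≤ x) :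
    ((ENNReal.ofReal x : ℝ≥0∞) : EReal) = (x : EReal) := by
  rw [EReal.coe_ennreal_ofReal, max_eq_left hx]

theorem coe_add_mul_coe_of_nonneg (hr : 0 ≤ r) (A K : ℝ≥0∞) :
    (A : EReal) + (r : EReal) * (K : EReal) = ((A + ENNReal.ofReal r * K : ℝ≥0∞) : EReal) := by
  rw [EReal.coe_ennreal_add, EReal.coe_ennreal_mul, coe_ennreal_ofReal_of_nonneg hr]

theorem coe_add_mul_top_of_neg (hr : r < 0) (A : ℝ≥0∞) :
    (A : EReal) + (r : EReal) * ((⊤ : ℝ≥0∞) : EReal) = ⊥ := by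
  rw [EReal.coe_ennreal_top, EReal.coe_mul_top_of_neg hr, EReal.add_bot]

theorem coe_add_add_mul_cancel (hr : r < 0) (hK : K ≠ ⊤) (B : ℝ≥0∞) :
    ((B + ENNReal.ofReal (-r) * K : ℝ≥0∞) : EReal) + (r : EReal) * (K : EReal) = (B : EReal) := by
  lift K to NNReal using hK
  rw [← coe_add_mul_coe_of_nonneg (neg_nonneg.2 hr.le), EReal.coe_nnreal_eq_coe_real,
    ← EReal.coe_mul, ← EReal.coe_mul, add_assoc, ← EReal.coe_add]
  simp

theorem coe_add_mul_le_of_neg (hr : r < 0) (h : A ≤ B + ENNReal.ofReal (-r) * K) :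
    (A : EReal) + (r : EReal) * (K : EReal) ≤ (B : EReal) := by
  by_cases hK : K = ⊤
  · rw [hK, coe_add_mul_top_of_neg hr]
    exact bot_le
  · rw [← coe_add_add_mul_cancel hr hK B]
    exact add_le_add_left (EReal.coe_ennreal_le_coe_ennreal_iff.2 h) _

theorem le_coe_add_mul_of_neg (hr : r < 0) (hK : K ≠ ⊤) (h : B + ENNReal.ofReal (-r) * K ≤ A) :
    (B : EReal) ≤ (A : EReal) + (r : EReal) * (K : EReal) := by
  rw [← coe_add_add_mul_cancel hr hK B]
  exact add_le_add_left (EReal.coe_ennreal_le_coe_ennreal_iff.2 h) _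

theorem coe_add_mul_eq_of_neg {D : ℝ≥0∞} (hr : r < 0) (hB : B ≠ ⊤) (hK : K ≠ ⊤)
    (h : A + ENNReal.ofReal (-r) * D = B + ENNReal.ofReal (-r) * K) :
    (A : EReal) + (r : EReal) * (K : EReal) = (B : EReal) + (r : EReal) * (D : EReal) := by
  have hD : D ≠ ⊤ := by
    rintro rfl
    have hw : ENNReal.ofReal (-r) ≠ 0 := by simpa using hr
    rw [ENNReal.mul_top hw, add_top] at h
    exact ENNReal.add_ne_top.2 ⟨hB, ENNReal.mul_ne_top ENNReal.ofReal_ne_top hK⟩ h.symm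
  rw [← coe_add_add_mul_cancel hr hD A, h, add_right_comm, coe_add_add_mul_cancel hr hK]

theorem coe_liminf_le {A : ℕ → ℝ≥0∞} {b : EReal} (h : ∀ m, ((A m : ℝ≥0∞) : EReal) ≤ b) :
    ((Filter.liminf A Filter.atTop : ℝ≥0∞) : EReal) ≤ b := by
  have hb : 0 ≤ b := (EReal.coe_ennreal_nonneg _).trans (h 0)
  rw [← EReal.coe_toENNReal hb] at h ⊢
  simp only [EReal.coe_ennreal_le_coe_ennreal_iff] at h ⊢
  exact (Filter.liminf_le_liminf (.of_forall h)).trans_eq (Filter.liminf_const _)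

end ERealPenalty

section Stage

theorem isArgOpt_iff {α : Type*} {lam : ℝ} {S : Set α} {J : α → EReal} {q : α} :
    IsArgOpt lam S J q ↔ q ∈ S ∧ J q = optOver lam S J := by
  refine and_congr_right fun hq => ?_
  unfold optOver
  split_ifs
  · exact ⟨fun h => le_antisymm (le_iInf₂ h) (iInf₂_le q hq), fun h q' hq' =>
      h.trans_le (iInf₂_le q' hq')⟩
  · exact ⟨fun h => le_antisymm (le_iSup₂ (f := fun q _ => J q) q hq) (iSup₂_le h), fun h q' hq' =>
      (le_iSup₂ q' hq').trans_eq h.symm⟩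

theorem tendsto_min_natCast (y : ℝ) :
    Filter.Tendsto (fun m : ℕ => min y m) Filter.atTop (nhds y) := by
  refine tendsto_const_nhds.congr' ?_
  filter_upwards [tendsto_natCast_atTop_atTop.eventually_ge_atTop y] with m hm
  exact (min_eq_left hm).symm

variable {α : Type*} [MeasurableSpace α] {μ ν : Measure α} {lam : ℝ} {f g : α → ℝ}

theorem klStage_mono (hfg : ∀ a, f a ≤ g a) : klStage lam μ f ν ≤ klStage lam μ g ν :=
  add_le_add_left (EReal.coe_ennreal_le_coe_ennreal_iff.2
    (lintegral_mono fun a => ENNReal.ofReal_le_ofReal (hfg a))) _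

variable [IsProbabilityMeasure μ]

theorem klStage_eq_entropicRisk_add (hl : lam ≠ 0) (hf : Measurable f) (hf0 : ∀ a, 0 ≤ f a)
    (hi : Integrable (fun a => Real.exp (-lam * f a)) μ) [IsProbabilityMeasure ν]
    (hK : lam < 0 → klDiv ν μ ≠ ⊤) :
    klStage lam μ f ν = (entropicRisk lam μ f : EReal)
      + ((1 / lam : ℝ) : EReal) * (klDiv ν (gibbsMeasure lam μ f) : EReal) := by
  rw [← coe_ennreal_ofReal_of_nonneg (entropicRisk_nonneg hf0)]
  rcases lt_or_gt_of_ne hl with hneg | hpos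
  · exact coe_add_mul_eq_of_neg (one_div_neg.2 hneg) ENNReal.ofReal_ne_top (hK hneg)
      (lintegral_add_klDiv_eq_of_neg hneg hf hf0 hi)
  · have hr : 0 ≤ 1 / lam := (one_div_pos.2 hpos).le
    rw [klStage, coe_add_mul_coe_of_nonneg hr, coe_add_mul_coe_of_nonneg hr,
      lintegral_add_klDiv_eq_of_pos hpos hf hf0]

theorem entropicRisk_le_klStage_of_pos (hl : 0 < lam) (hf : Measurable f) (hf0 : ∀ a, 0 ≤ f a)
    [IsProbabilityMeasure ν] : (entropicRisk lam μ f : EReal) ≤ klStage lam μ f ν := by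
  rw [klStage_eq_entropicRisk_add hl.ne' hf hf0 (integrable_exp_neg_mul_of_pos hl hf hf0)
    fun hneg => absurd hl hneg.not_gt]
  exact le_add_of_nonneg_right
    (mul_nonneg (EReal.coe_nonneg.2 (one_div_pos.2 hl).le) (EReal.coe_ennreal_nonneg _))

theorem klStage_le_entropicRisk_of_neg (hl : lam < 0) (hf : Measurable f) (hf0 : ∀ a, 0 ≤ f a)
    (hi : Integrable (fun a => Real.exp (-lam * f a)) μ) [IsProbabilityMeasure ν] :
    klStage lam μ f ν ≤ (entropicRisk lam μ f : EReal) := by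
  rw [← coe_ennreal_ofReal_of_nonneg (entropicRisk_nonneg hf0)]
  refine coe_add_mul_le_of_neg (one_div_neg.2 hl) ?_
  rw [← lintegral_add_klDiv_eq_of_neg hl hf hf0 hi]
  exact le_self_add

theorem eq_gibbsMeasure_of_klStage_eq (hl : lam ≠ 0) (hf : Measurable f) (hf0 : ∀ a, 0 ≤ f a)
    (hi : Integrable (fun a => Real.exp (-lam * f a)) μ) [IsProbabilityMeasure ν]
    (h : klStage lam μ f ν = (entropicRisk lam μ f : EReal)) : ν = gibbsMeasure lam μ f := by
  have := isProbabilityMeasure_tilted hi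
  have hK : lam < 0 → klDiv ν μ ≠ ⊤ := fun hneg hK => by
    rw [klStage, hK, coe_add_mul_top_of_neg (one_div_neg.2 hneg)] at h
    exact EReal.bot_ne_coe _ h
  rw [klStage_eq_entropicRisk_add hl hf hf0 hi hK] at h
  have hgap : ((1 / lam : ℝ) : EReal) * (klDiv ν (gibbsMeasure lam μ f) : EReal) = 0 :=
    EReal.add_sub_cancel_left.symm.trans (by rw [h, ← EReal.coe_sub, sub_self, EReal.coe_zero])
  rw [← klDiv_eq_zero_iff, ← EReal.coe_ennreal_eq_zero]
  exact (mul_eq_zero.1 hgap).resolve_left (by simpa using hl)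

theorem klStage_gibbsMeasure (hl : lam ≠ 0) (hf : Measurable f) (hf0 : ∀ a, 0 ≤ f a)
    (hi : Integrable (fun a => Real.exp (-lam * f a)) μ)
    (hK : lam < 0 → klDiv (gibbsMeasure lam μ f) μ ≠ ⊤) :
    klStage lam μ f (gibbsMeasure lam μ f) = (entropicRisk lam μ f : EReal) := by
  have := isProbabilityMeasure_tilted hi
  rw [klStage_eq_entropicRisk_add hl hf hf0 hi hK, klDiv_self, EReal.coe_ennreal_zero, mul_zero,
    add_zero]

theorem optOver_klStage_of_pos (hl : 0 < lam) (hf : Measurable f) (hf0 : ∀ a, 0 ≤ f a) :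
    optOver lam (probMeasures α) (klStage lam μ f) = (entropicRisk lam μ f : EReal) := by
  have hi := integrable_exp_neg_mul_of_pos (μ := μ) hl hf hf0
  rw [optOver, if_pos hl]
  refine le_antisymm ?_ (le_iInf₂ fun ν hν => ?_)
  · exact (iInf₂_le (gibbsMeasure lam μ f) (isProbabilityMeasure_tilted hi)).trans_eq
      (klStage_gibbsMeasure hl.ne' hf hf0 hi fun hneg => absurd hl hneg.not_gt)
  · have : IsProbabilityMeasure ν := hν
    exact entropicRisk_le_klStage_of_pos hl hf hf0

/-- The Gibbs measure of `f` may have infinite divergence, and then it does not attain the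
supremum; the Gibbs measures of the truncations `min f m` have finite divergence and approach it. -/
theorem optOver_klStage_of_neg (hl : lam < 0) (hf : Measurable f) (hf0 : ∀ a, 0 ≤ f a)
    (hi : Integrable (fun a => Real.exp (-lam * f a)) μ) :
    optOver lam (probMeasures α) (klStage lam μ f) = (entropicRisk lam μ f : EReal) := by
  rw [optOver, if_neg hl.not_gt]
  refine le_antisymm (iSup₂_le fun ν hν => ?_) ?_
  · have : IsProbabilityMeasure ν := hν
    exact klStage_le_entropicRisk_of_neg hl hf hf0 hi
  have hmeas (m : ℕ) : Measurable fun a => min (f a) (m : ℝ) := by fun_prop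
  have hnonneg (m : ℕ) (a : α) : 0 ≤ min (f a) (m : ℝ) := le_min (hf0 a) m.cast_nonneg
  have hlim : Filter.Tendsto (fun m : ℕ => entropicRisk lam μ fun a => min (f a) (m : ℝ))
      Filter.atTop (nhds (entropicRisk lam μ f)) :=
    tendsto_entropicRisk hmeas hnonneg (fun m a => min_le_left _ _) hi
      fun a => tendsto_min_natCast (f a)
  refine le_of_tendsto ((continuous_coe_real_ereal.tendsto _).comp hlim) (.of_forall fun m => ?_)
  have him : Integrable (fun a => Real.exp (-lam * min (f a) (m : ℝ))) μ :=
    integrable_exp_neg_mul_of_le (hmeas m) (hnonneg m) (fun a => min_le_left _ _) hi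
  have hK : klDiv (gibbsMeasure lam μ fun a => min (f a) (m : ℝ)) μ ≠ ⊤ :=
    ne_top_of_le_ne_top ENNReal.ofReal_ne_top
      (klDiv_gibbsMeasure_self_le_of_neg hl (hmeas m) (hnonneg m) fun a => min_le_right _ _)
  rw [Function.comp_apply, ← klStage_gibbsMeasure hl.ne (hmeas m) (hnonneg m) him fun _ => hK]
  exact (klStage_mono fun a => min_le_left _ _).trans
    (le_iSup₂ (f := fun ν _ => klStage lam μ f ν) _ (isProbabilityMeasure_tilted him))

theorem optOver_klStage (hl : lam ≠ 0) (hf : Measurable f) (hf0 : ∀ a, 0 ≤ f a)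
    (hi : Integrable (fun a => Real.exp (-lam * f a)) μ) :
    optOver lam (probMeasures α) (klStage lam μ f) = (entropicRisk lam μ f : EReal) :=
  hl.lt_or_gt.elim (optOver_klStage_of_neg · hf hf0 hi) (optOver_klStage_of_pos · hf hf0)

theorem isArgOpt_klStage_iff (hl : lam ≠ 0) (hf : Measurable f) (hf0 : ∀ a, 0 ≤ f a)
    (hi : Integrable (fun a => Real.exp (-lam * f a)) μ)
    (hK : lam < 0 → klDiv (gibbsMeasure lam μ f) μ ≠ ⊤) (ν : Measure α) :
    IsArgOpt lam (probMeasures α) (klStage lam μ f) ν ↔ ν = gibbsMeasure lam μ f := by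
  rw [isArgOpt_iff, optOver_klStage hl hf hf0 hi]
  constructor
  · rintro ⟨hν, hval⟩
    have : IsProbabilityMeasure ν := hν
    exact eq_gibbsMeasure_of_klStage_eq hl hf hf0 hi hval
  · rintro rfl
    exact ⟨isProbabilityMeasure_tilted hi, klStage_gibbsMeasure hl hf hf0 hi hK⟩

end Stage

section Trajectories

variable {X U : Type*}

/-- The additive functional of a trajectory of `n` steps that starts at time `t`: running terms
`r k (x_k, u_k)` plus the terminal term `g` of the last state. -/
def pathSum (r : ℕ → X × U → ℝ≥0∞) (g : X → ℝ≥0∞) (n t : ℕ) (ξ : Trajectory X U n) : ℝ≥0∞ :=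
  (∑ k : Fin n, r (t + k) (ξ.1 k.castSucc, ξ.2 k)) + g (ξ.1 (Fin.last _))

theorem pathSum_cons (r : ℕ → X × U → ℝ≥0∞) (g : X → ℝ≥0∞) (n t : ℕ) (x : X) (u : U)
    (ξ : Trajectory X U n) :
    pathSum r g (n + 1) t (Trajectory.cons (x, u, ξ)) = r t (x, u) + pathSum r g n (t + 1) ξ := by
  unfold pathSum Trajectory.cons
  rw [Fin.sum_univ_succ, add_assoc]
  simp only [Fin.val_zero, add_zero, Fin.castSucc_zero, Fin.cons_zero, Fin.val_succ,
    ← Fin.succ_castSucc, Fin.cons_succ, ← Fin.succ_last]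
  congr 2
  exact Finset.sum_congr rfl fun k _ => by rw [add_right_comm, add_assoc]

theorem pathSum_add (r s : ℕ → X × U → ℝ≥0∞) (g : X → ℝ≥0∞) (n t : ℕ) (ξ : Trajectory X U n) :
    pathSum (r + s) g n t ξ = pathSum r g n t ξ + pathSum s 0 n t ξ := by
  simp only [pathSum, Pi.add_apply, Finset.sum_add_distrib, Pi.zero_apply]
  abel

theorem pathSum_smul (w : ℝ≥0∞) (r : ℕ → X × U → ℝ≥0∞) (n t : ℕ) (ξ : Trajectory X U n) :
    pathSum (w • r) 0 n t ξ = w * pathSum r 0 n t ξ := by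
  simp [pathSum, Finset.mul_sum]

variable [MeasurableSpace X] [MeasurableSpace U] {π : ℕ → Kernel X U} {τ : ℕ → Kernel (X × U) X}
  {r s : ℕ → X × U → ℝ≥0∞} {g : X → ℝ≥0∞} {N n t : ℕ}

theorem measurable_pathSum (hr : ∀ k < N, Measurable (r k)) (hg : Measurable g)
    (hn : t + n ≤ N) : Measurable (pathSum r g n t) := by
  unfold pathSum
  refine Measurable.add (Finset.measurable_sum _ fun k _ => ?_) (by fun_prop)
  exact (hr _ (by omega)).comp (by fun_prop)

theorem isMarkovKernel_trajKernel (hπ : ∀ k < N, IsMarkovKernel (π k))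
    (hτ : ∀ k < N, IsMarkovKernel (τ k)) (hn : t + n ≤ N) :
    IsMarkovKernel (trajKernel π τ n t) := by
  induction n generalizing t with
  | zero => unfold trajKernel; infer_instance
  | succ n ih =>
    have := hπ t (by omega)
    have := hτ t (by omega)
    have := ih (t := t + 1) (by omega)
    exact Kernel.IsMarkovKernel.map _ Trajectory.measurable_cons

theorem lintegral_trajKernel_zero (π : ℕ → Kernel X U) (τ : ℕ → Kernel (X × U) X)
    (r : ℕ → X × U → ℝ≥0∞) (hg : Measurable g) (t : ℕ) (x : X) :
    ∫⁻ ξ, pathSum r g 0 t ξ ∂(trajKernel π τ 0 t x) = g x := by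
  have hlast : pathSum r g 0 t = fun ξ => g (ξ.1 0) := by
    funext ξ
    simp [pathSum]
  rw [trajKernel, hlast, Kernel.lintegral_deterministic' _ (by fun_prop)]

theorem lintegral_trajKernel_succ (hπ : ∀ k < N, IsMarkovKernel (π k))
    (hτ : ∀ k < N, IsMarkovKernel (τ k)) (hr : ∀ k < N, Measurable (r k)) (hg : Measurable g)
    (hn : t + (n + 1) ≤ N) (x : X) :
    ∫⁻ ξ, pathSum r g (n + 1) t ξ ∂(trajKernel π τ (n + 1) t x)
      = ∫⁻ u, (r t (x, u) + ∫⁻ x', ∫⁻ ξ, pathSum r g n (t + 1) ξ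
          ∂(trajKernel π τ n (t + 1) x') ∂(τ t (x, u))) ∂(π t x) := by
  have := hπ t (by omega)
  have := hτ t (by omega)
  have hn' : t + 1 + n ≤ N := by omega
  have := isMarkovKernel_trajKernel hπ hτ hn'
  have hrt : Measurable (r t) := hr t (by omega)
  have hS : Measurable (pathSum r g (n + 1) t) := measurable_pathSum hr hg hn
  have hS' : Measurable (pathSum r g n (t + 1)) := measurable_pathSum hr hg hn'
  have hcons : Measurable fun p : X × U × Trajectory X U n =>
      pathSum r g (n + 1) t (Trajectory.cons p) := hS.comp Trajectory.measurable_cons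
  have hsplit (p : U × Trajectory X U n) : pathSum r g (n + 1) t (Trajectory.cons (x, p))
      = r t (x, p.1) + pathSum r g n (t + 1) p.2 := pathSum_cons r g n t x p.1 p.2
  rw [trajKernel, Kernel.lintegral_map _ Trajectory.measurable_cons _ hS,
    Kernel.lintegral_id_prod hcons]
  simp only [hsplit]
  rw [Kernel.lintegral_compProd _ _ _ (by fun_prop)]
  refine lintegral_congr fun u => ?_
  rw [lintegral_add_left (by fun_prop), Kernel.lintegral_comp _ _ _ hS']
  simp

theorem add_lintegral_pathSum_eq {a : ℕ → X → ℝ≥0∞} (hπ : ∀ k < N, IsMarkovKernel (π k))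
    (hτ : ∀ k < N, IsMarkovKernel (τ k)) (hr : ∀ k < N, Measurable (r k))
    (hs : ∀ k < N, Measurable (s k)) (ha : ∀ k, Measurable (a k))
    (hstep : ∀ k < N, ∀ x, a k x + ∫⁻ u, s k (x, u) ∂(π k x)
      = ∫⁻ u, (r k (x, u) + ∫⁻ x', a (k + 1) x' ∂(τ k (x, u))) ∂(π k x))
    (hn : t + n = N) (x : X) :
    a t x + ∫⁻ ξ, pathSum s 0 n t ξ ∂(trajKernel π τ n t x)
      = ∫⁻ ξ, pathSum r (a N) n t ξ ∂(trajKernel π τ n t x) := by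
  induction n generalizing t x with
  | zero =>
    rw [lintegral_trajKernel_zero _ _ _ measurable_zero, lintegral_trajKernel_zero _ _ _ (ha N)]
    simp [← hn]
  | succ n ih =>
    have htN : t < N := by omega
    have := hτ t htN
    have hst := hs t htN
    have hrt := hr t htN
    have : Measurable fun x' =>
        ∫⁻ ξ, pathSum s 0 n (t + 1) ξ ∂(trajKernel π τ n (t + 1) x') :=
      (measurable_pathSum hs measurable_zero (by omega)).lintegral_kernel
    have : Measurable fun z => ∫⁻ x', a (t + 1) x' ∂(τ t z) := (ha (t + 1)).lintegral_kernel
    rw [lintegral_trajKernel_succ hπ hτ hs measurable_zero hn.le,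
      lintegral_trajKernel_succ hπ hτ hr (ha N) hn.le, lintegral_add_left (by fun_prop),
      ← add_assoc, hstep t htN x, ← lintegral_add_left (by fun_prop)]
    refine lintegral_congr fun u => ?_
    rw [add_assoc, ← lintegral_add_left (ha _)]
    simp only [ih (show t + 1 + n = N by omega)]

end Trajectories

namespace KLControl

variable {X U : Type*} [MeasurableSpace X] [MeasurableSpace U] (P : KLControl X U)

section Recursion

theorem measurable_valueAux (n t : ℕ) : Measurable (P.valueAux n t) := by
  induction n generalizing t with
  | zero => exact P.cT_measurable
  | succ n ih =>
    have hc := P.c_measurable t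
    have hrec := ih (t + 1)
    have hQ : Measurable fun z : X × U => entropicRisk P.lamS (P.ι t z)
        fun x' => P.c t z + P.valueAux n (t + 1) x' :=
      measurable_entropicRisk
        (f := fun p : (X × U) × X => P.c t p.1 + P.valueAux n (t + 1) p.2) (by fun_prop) _
    exact measurable_entropicRisk hQ _

theorem valueAux_nonneg (n t : ℕ) (x : X) : 0 ≤ P.valueAux n t x := by
  induction n generalizing t x with
  | zero => exact P.cT_nonneg x
  | succ n ih =>
    exact entropicRisk_nonneg fun u => entropicRisk_nonneg fun x' =>
      add_nonneg (P.c_nonneg _ _) (ih _ _)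

theorem measurable_V (t : ℕ) : Measurable (P.V t) := P.measurable_valueAux _ _

theorem V_nonneg (t : ℕ) (x : X) : 0 ≤ P.V t x := P.valueAux_nonneg _ _ _

theorem V_T (x : X) : P.V P.T x = P.cT x := by
  unfold V
  rw [Nat.sub_self]
  rfl

theorem V_of_lt {t : ℕ} (ht : t < P.T) (x : X) :
    P.V t x = entropicRisk P.lamP (P.ρ t x) fun u => P.Q t (x, u) := by
  unfold V
  rw [show P.T - t = P.T - (t + 1) + 1 by omega]
  rfl

theorem measurable_c_add_V (t : ℕ) :
    Measurable fun p : (X × U) × X => P.c t p.1 + P.V (t + 1) p.2 := by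
  have hc := P.c_measurable t
  have hV := P.measurable_V (t + 1)
  fun_prop

theorem c_add_V_nonneg (t : ℕ) (z : X × U) (x' : X) : 0 ≤ P.c t z + P.V (t + 1) x' :=
  add_nonneg (P.c_nonneg t z) (P.V_nonneg (t + 1) x')

theorem measurable_Q (t : ℕ) : Measurable (P.Q t) :=
  measurable_entropicRisk (P.measurable_c_add_V t) _

theorem Q_nonneg (t : ℕ) (z : X × U) : 0 ≤ P.Q t z :=
  entropicRisk_nonneg (P.c_add_V_nonneg t z)

theorem integrable_exp_Q (t : ℕ) (x : X) :
    Integrable (fun u => Real.exp (-P.lamP * P.Q t (x, u))) (P.ρ t x) :=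
  integrable_exp_neg_mul_of_pos P.lamP_pos ((P.measurable_Q t).comp measurable_prodMk_left)
    fun u => P.Q_nonneg t (x, u)

theorem optPolicy_apply {t : ℕ} (ht : t < P.T) (x : X) :
    P.optPolicy t x = gibbsMeasure P.lamP (P.ρ t x) fun u => P.Q t (x, u) := by
  rw [← withDensity_entropicRisk_apply (P.measurable_Q t) P.lamP_pos.ne' (P.integrable_exp_Q t x)]
  unfold optPolicy
  simp only [P.V_of_lt ht]

theorem optPolicy_mem_policies : P.optPolicy ∈ P.policies := fun t ht => ⟨fun x => by
  rw [P.optPolicy_apply ht]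
  exact isProbabilityMeasure_tilted (P.integrable_exp_Q t x)⟩

/-- Finiteness of the exponential moments `E_{ι_t}[exp(-λ^S (c_t + V_{t+1}))]` that normalize the
tilted kernels. -/
def HasExpMoments : Prop :=
  ∀ t < P.T, ∀ z : X × U,
    Integrable (fun x' => Real.exp (-P.lamS * (P.c t z + P.V (t + 1) x'))) (P.ι t z)

variable {P}

theorem hasExpMoments_of_pos (hS : 0 < P.lamS) : P.HasExpMoments := fun t _ z =>
  integrable_exp_neg_mul_of_pos hS ((P.measurable_V (t + 1)).const_add _) (P.c_add_V_nonneg t z)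

theorem HasExpMoments.optTransition_apply (hi : P.HasExpMoments) {t : ℕ} (ht : t < P.T)
    (z : X × U) :
    P.optTransition t z
      = gibbsMeasure P.lamS (P.ι t z) fun x' => P.c t z + P.V (t + 1) x' :=
  withDensity_entropicRisk_apply (P.measurable_c_add_V t) P.lamS_ne_zero (hi t ht z)

theorem HasExpMoments.optTransition_mem_transitions (hi : P.HasExpMoments) :
    P.optTransition ∈ P.transitions := fun t ht => ⟨fun z => by
  rw [hi.optTransition_apply ht]
  exact isProbabilityMeasure_tilted (hi t ht z)⟩

end Recursion

section StageOptimality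

theorem klStage_optPolicy {t : ℕ} (ht : t < P.T) (x : X) :
    klStage P.lamP (P.ρ t x) (fun u => P.Q t (x, u)) (P.optPolicy t x)
      = ((P.V t x : ℝ) : EReal) := by
  rw [P.optPolicy_apply ht, P.V_of_lt ht]
  exact klStage_gibbsMeasure P.lamP_pos.ne' ((P.measurable_Q t).comp measurable_prodMk_left)
    (fun u => P.Q_nonneg t (x, u)) (P.integrable_exp_Q t x) fun h => absurd h P.lamP_pos.not_gt

theorem isLeast_klStage_Q {t : ℕ} (ht : t < P.T) (x : X) :
    IsLeast (klStage P.lamP (P.ρ t x) (fun u => P.Q t (x, u)) '' probMeasures U)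
      ((P.V t x : ℝ) : EReal) := by
  refine ⟨⟨_, (P.optPolicy_mem_policies t ht).isProbabilityMeasure x, P.klStage_optPolicy ht x⟩, ?_⟩
  rintro _ ⟨ν, hν, rfl⟩
  have : IsProbabilityMeasure ν := hν
  rw [P.V_of_lt ht]
  exact entropicRisk_le_klStage_of_pos P.lamP_pos
    ((P.measurable_Q t).comp measurable_prodMk_left) fun u => P.Q_nonneg t (x, u)

theorem klStage_Q_eq_V_iff {t : ℕ} (ht : t < P.T) (x : X) {ν : Measure U}
    (hν : ν ∈ probMeasures U) :
    klStage P.lamP (P.ρ t x) (fun u => P.Q t (x, u)) ν = ((P.V t x : ℝ) : EReal)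
      ↔ ν = P.optPolicy t x := by
  refine ⟨fun h => ?_, fun h => h ▸ P.klStage_optPolicy ht x⟩
  have : IsProbabilityMeasure ν := hν
  rw [P.V_of_lt ht] at h
  rw [P.optPolicy_apply ht]
  exact eq_gibbsMeasure_of_klStage_eq P.lamP_pos.ne'
    ((P.measurable_Q t).comp measurable_prodMk_left) (fun u => P.Q_nonneg t (x, u))
    (P.integrable_exp_Q t x) h

theorem optPolicy_eq_withDensity {t : ℕ} (ht : t < P.T) (x : X) :
    P.optPolicy t x = (P.ρ t x).withDensity fun u =>
      ENNReal.ofReal (Real.exp (-P.lamP * P.Q t (x, u)) / Real.exp (-P.lamP * P.V t x)) := by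
  rw [P.optPolicy_apply ht, P.V_of_lt ht]
  exact gibbsMeasure_eq_withDensity P.lamP_pos.ne' (P.integrable_exp_Q t x)

namespace HasExpMoments

variable {P} (hi : P.HasExpMoments) {t : ℕ} (ht : t < P.T) (z : X × U)
include hi ht

theorem optOver_klStage_c_add_V :
    optOver P.lamS (probMeasures X) (klStage P.lamS (P.ι t z) fun x' => P.c t z + P.V (t + 1) x')
      = ((P.Q t z : ℝ) : EReal) :=
  optOver_klStage P.lamS_ne_zero ((P.measurable_V (t + 1)).const_add _) (P.c_add_V_nonneg t z)
    (hi t ht z)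

theorem eq_optTransition_of_klStage_eq {ν : Measure X} (hν : ν ∈ probMeasures X)
    (h : klStage P.lamS (P.ι t z) (fun x' => P.c t z + P.V (t + 1) x') ν
      = ((P.Q t z : ℝ) : EReal)) : ν = P.optTransition t z := by
  have : IsProbabilityMeasure ν := hν
  rw [hi.optTransition_apply ht]
  exact eq_gibbsMeasure_of_klStage_eq P.lamS_ne_zero ((P.measurable_V (t + 1)).const_add _)
    (P.c_add_V_nonneg t z) (hi t ht z) h

theorem klStage_optTransition (hK : P.lamS < 0 → klDiv (P.optTransition t z) (P.ι t z) ≠ ⊤) :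
    klStage P.lamS (P.ι t z) (fun x' => P.c t z + P.V (t + 1) x') (P.optTransition t z)
      = ((P.Q t z : ℝ) : EReal) := by
  rw [hi.optTransition_apply ht] at hK ⊢
  exact klStage_gibbsMeasure P.lamS_ne_zero ((P.measurable_V (t + 1)).const_add _)
    (P.c_add_V_nonneg t z) (hi t ht z) hK

theorem isArgOpt_klStage_V_iff (hK : P.lamS < 0 → klDiv (P.optTransition t z) (P.ι t z) ≠ ⊤)
    (ν : Measure X) :
    IsArgOpt P.lamS (probMeasures X) (klStage P.lamS (P.ι t z) (P.V (t + 1))) ν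
      ↔ ν = P.optTransition t z := by
  have hV := P.measurable_V (t + 1)
  have hV0 := P.V_nonneg (t + 1)
  rw [hi.optTransition_apply ht, gibbsMeasure_const_add] at hK ⊢
  exact isArgOpt_klStage_iff P.lamS_ne_zero hV hV0 (integrable_exp_neg_mul_of_le hV hV0
    (fun _ => le_add_of_nonneg_left (P.c_nonneg t z)) (hi t ht z)) hK ν

theorem optTransition_eq_withDensity :
    P.optTransition t z = (P.ι t z).withDensity fun x' => ENNReal.ofReal
      (Real.exp (-P.lamS * (P.c t z + P.V (t + 1) x')) / Real.exp (-P.lamS * P.Q t z)) := by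
  rw [hi.optTransition_apply ht]
  exact gibbsMeasure_eq_withDensity P.lamS_ne_zero (hi t ht z)

end HasExpMoments

end StageOptimality

section Objective

/-- The expectation of the additive functional `pathSum r g` over the trajectory from time `t` to
the horizon, when the state at time `t` has law `μ`. -/
def expPathSum (t : ℕ) (μ : Measure X) (π : ℕ → Kernel X U) (τ : ℕ → Kernel (X × U) X)
    (r : ℕ → X × U → ℝ≥0∞) (g : X → ℝ≥0∞) : ℝ≥0∞ :=
  ∫⁻ ξ, pathSum r g (P.T - t) t ξ ∂(P.law π τ t μ)

/-- The part of the objective that the policies and kernels influence with positive sign: expected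
cumulative cost plus `(1/λ^P)` times the expected policy penalty. -/
def policyCost (t : ℕ) (μ : Measure X) (π : ℕ → Kernel X U) (τ : ℕ → Kernel (X × U) X) : ℝ≥0∞ :=
  ∫⁻ ξ, P.cumCost t ξ ∂(P.law π τ t μ)
    + ENNReal.ofReal (1 / P.lamP) * ∫⁻ ξ, P.policyKL π t ξ ∂(P.law π τ t μ)

/-- The expected divergence of the policies `π` from the tilted policies `π*`. -/
def policyGap (t : ℕ) (μ : Measure X) (π : ℕ → Kernel X U) (τ : ℕ → Kernel (X × U) X) : ℝ≥0∞ :=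
  P.expPathSum t μ π τ (fun k z => klDiv (π k z.1) (P.optPolicy k z.1)) 0

/-- The expected divergence of the transition kernels `τ` from the tilted kernels `τ*`. -/
def transitionGap (t : ℕ) (μ : Measure X) (π : ℕ → Kernel X U) (τ : ℕ → Kernel (X × U) X) :
    ℝ≥0∞ :=
  P.expPathSum t μ π τ (fun k z => klDiv (τ k z) (P.optTransition k z)) 0

variable (t : ℕ) (μ : Measure X) {π : ℕ → Kernel X U} {τ : ℕ → Kernel (X × U) X}
  {r s : ℕ → X × U → ℝ≥0∞} {g : X → ℝ≥0∞}

theorem objective_eq (π : ℕ → Kernel X U) (τ : ℕ → Kernel (X × U) X) :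
    P.objective t μ π τ = ((P.policyCost t μ π τ : ℝ≥0∞) : EReal)
      + ((1 / P.lamS : ℝ) : EReal) * ((P.expTransitionKL t μ π τ : ℝ≥0∞) : EReal) := by
  unfold objective policyCost
  rw [coe_add_mul_coe_of_nonneg (one_div_pos.2 P.lamP_pos).le]

theorem expTransitionKL_eq_expPathSum (π : ℕ → Kernel X U) (τ : ℕ → Kernel (X × U) X) :
    P.expTransitionKL t μ π τ
      = P.expPathSum t μ π τ (fun k z => klDiv (τ k z) (P.ι k z)) 0 := by
  simp [expTransitionKL, expPathSum, transitionKL, pathSum]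

theorem policyCost_eq_expPathSum (π : ℕ → Kernel X U) (τ : ℕ → Kernel (X × U) X) :
    P.policyCost t μ π τ
      = P.expPathSum t μ π τ (fun k z => ENNReal.ofReal (P.c k z))
          (fun x => ENNReal.ofReal (P.cT x))
        + ENNReal.ofReal (1 / P.lamP)
          * P.expPathSum t μ π τ (fun k z => klDiv (π k z.1) (P.ρ k z.1)) 0 := by
  simp [policyCost, expPathSum, cumCost, policyKL, pathSum]

variable {t μ}

theorem expPathSum_add (ht : t ≤ P.T) (hr : ∀ k < P.T, Measurable (r k)) (hg : Measurable g) :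
    P.expPathSum t μ π τ (r + s) g = P.expPathSum t μ π τ r g + P.expPathSum t μ π τ s 0 := by
  unfold expPathSum
  simp only [pathSum_add]
  exact lintegral_add_left (measurable_pathSum hr hg (by omega)) _

theorem expPathSum_smul (ht : t ≤ P.T) (w : ℝ≥0∞) (hr : ∀ k < P.T, Measurable (r k)) :
    P.expPathSum t μ π τ (w • r) 0 = w * P.expPathSum t μ π τ r 0 := by
  unfold expPathSum
  simp only [pathSum_smul]
  exact lintegral_const_mul _ (measurable_pathSum hr measurable_zero (by omega))

theorem expPathSum_eq_zero (h : ∀ k < P.T, ∀ z, r k z = 0) :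
    P.expPathSum t μ π τ r 0 = 0 := by
  have hzero (ξ : Trajectory X U (P.T - t)) : pathSum r 0 (P.T - t) t ξ = 0 := by
    unfold pathSum
    simp only [Pi.zero_apply, add_zero]
    exact Finset.sum_eq_zero fun k _ => h _ (by omega) _
  simp [expPathSum, hzero]

theorem expPathSum_eq_lintegral (ht : t ≤ P.T) (hr : ∀ k < P.T, Measurable (r k))
    (hg : Measurable g) :
    P.expPathSum t μ π τ r g
      = ∫⁻ x, ∫⁻ ξ, pathSum r g (P.T - t) t ξ ∂(trajKernel π τ (P.T - t) t x) ∂μ :=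
  Measure.lintegral_bind (Kernel.aemeasurable _)
    (measurable_pathSum hr hg (by omega)).aemeasurable

theorem lintegral_add_expPathSum_eq (hπ : π ∈ P.policies) (hτ : τ ∈ P.transitions)
    (ht : t ≤ P.T) {a : ℕ → X → ℝ≥0∞} (hr : ∀ k < P.T, Measurable (r k))
    (hs : ∀ k < P.T, Measurable (s k)) (ha : ∀ k, Measurable (a k))
    (hstep : ∀ k < P.T, ∀ x, a k x + ∫⁻ u, s k (x, u) ∂(π k x)
      = ∫⁻ u, (r k (x, u) + ∫⁻ x', a (k + 1) x' ∂(τ k (x, u))) ∂(π k x)) :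
    ∫⁻ x, a t x ∂μ + P.expPathSum t μ π τ s 0 = P.expPathSum t μ π τ r (a P.T) := by
  rw [P.expPathSum_eq_lintegral ht hs measurable_zero, P.expPathSum_eq_lintegral ht hr (ha _),
    ← lintegral_add_left (ha t)]
  exact lintegral_congr fun x =>
    add_lintegral_pathSum_eq hπ hτ hr hs ha hstep (by omega) x

end Objective

section Decomposition

variable {π : ℕ → Kernel X U} {τ : ℕ → Kernel (X × U) X}

theorem measurable_klDiv_policy [MeasurableSpace.CountablyGenerated U] (hπ : π ∈ P.policies)
    {π' : ℕ → Kernel X U} (hπ' : π' ∈ P.policies) {k : ℕ} (hk : k < P.T) :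
    Measurable fun z : X × U => klDiv (π k z.1) (π' k z.1) := by
  have := hπ k hk
  have := hπ' k hk
  exact (measurable_klDiv_kernel (π k) (π' k)).comp measurable_fst

theorem measurable_klDiv_transition [MeasurableSpace.CountablyGenerated X]
    (hτ : τ ∈ P.transitions) {τ' : ℕ → Kernel (X × U) X} (hτ' : τ' ∈ P.transitions) {k : ℕ}
    (hk : k < P.T) : Measurable fun z => klDiv (τ k z) (τ' k z) := by
  have := hτ k hk
  have := hτ' k hk
  exact measurable_klDiv_kernel _ _

theorem ρ_mem_policies : P.ρ ∈ P.policies := fun t _ => P.ρ_markov t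

theorem ι_mem_transitions : P.ι ∈ P.transitions := fun t _ => P.ι_markov t

theorem policyGap_optPolicy (t : ℕ) (μ : Measure X) (τ : ℕ → Kernel (X × U) X) :
    P.policyGap t μ P.optPolicy τ = 0 :=
  P.expPathSum_eq_zero fun k hk z => by
    have := P.optPolicy_mem_policies k hk
    exact klDiv_self _

theorem HasExpMoments.transitionGap_optTransition {P : KLControl X U} (hi : P.HasExpMoments)
    (t : ℕ) (μ : Measure X) (π : ℕ → Kernel X U) :
    P.transitionGap t μ π P.optTransition = 0 :=
  P.expPathSum_eq_zero fun k hk z => by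
    have := hi.optTransition_mem_transitions k hk
    exact klDiv_self _

theorem V_add_klDiv_optPolicy_eq (hπ : π ∈ P.policies) {k : ℕ} (hk : k < P.T) (x : X) :
    ENNReal.ofReal (P.V k x) + ENNReal.ofReal (1 / P.lamP) * klDiv (π k x) (P.optPolicy k x)
      = ∫⁻ u, ENNReal.ofReal (P.Q k (x, u)) ∂(π k x)
        + ENNReal.ofReal (1 / P.lamP) * klDiv (π k x) (P.ρ k x) := by
  have := hπ k hk
  rw [P.V_of_lt hk, P.optPolicy_apply hk]
  exact (lintegral_add_klDiv_eq_of_pos P.lamP_pos ((P.measurable_Q k).comp measurable_prodMk_left)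
    fun u => P.Q_nonneg k (x, u)).symm

theorem lintegral_c_add_V {k : ℕ} (z : X × U) (ν : Measure X) [IsProbabilityMeasure ν] :
    ∫⁻ x', ENNReal.ofReal (P.c k z + P.V (k + 1) x') ∂ν
      = ENNReal.ofReal (P.c k z) + ∫⁻ x', ENNReal.ofReal (P.V (k + 1) x') ∂ν := by
  simp only [ENNReal.ofReal_add (P.c_nonneg k z) (P.V_nonneg (k + 1) _)]
  rw [lintegral_add_left measurable_const, lintegral_const, measure_univ, mul_one]

theorem V_add_lintegral_gap_eq (hπ : π ∈ P.policies) (hτ : τ ∈ P.transitions) {k : ℕ}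
    (hk : k < P.T) {D E : X × U → ℝ≥0∞} (hstep : ∀ z,
      ∫⁻ x', ENNReal.ofReal (P.c k z + P.V (k + 1) x') ∂(τ k z) + D z
        = ENNReal.ofReal (P.Q k z) + E z) (x : X) :
    ENNReal.ofReal (P.V k x) + ∫⁻ u, (ENNReal.ofReal (1 / P.lamP)
          * klDiv (π k x) (P.optPolicy k x) + E (x, u)) ∂(π k x)
      = ∫⁻ u, (ENNReal.ofReal (P.c k (x, u)) + ENNReal.ofReal (1 / P.lamP)
          * klDiv (π k x) (P.ρ k x) + D (x, u)
          + ∫⁻ x', ENNReal.ofReal (P.V (k + 1) x') ∂(τ k (x, u))) ∂(π k x) := by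
  have := hπ k hk
  set pen := ENNReal.ofReal (1 / P.lamP) * klDiv (π k x) (P.ρ k x)
  have hQ : Measurable fun u => ENNReal.ofReal (P.Q k (x, u)) :=
    ((P.measurable_Q k).comp measurable_prodMk_left).ennreal_ofReal
  have hintegrand (u : U) : ENNReal.ofReal (P.c k (x, u)) + pen + D (x, u)
      + ∫⁻ x', ENNReal.ofReal (P.V (k + 1) x') ∂(τ k (x, u))
      = pen + (ENNReal.ofReal (P.Q k (x, u)) + E (x, u)) := by
    have := hτ k hk
    rw [← hstep, P.lintegral_c_add_V]
    ring
  simp only [hintegrand]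
  rw [lintegral_add_left measurable_const, lintegral_add_left measurable_const,
    lintegral_add_left hQ]
  simp only [lintegral_const, measure_univ, mul_one]
  rw [← add_assoc, P.V_add_klDiv_optPolicy_eq hπ hk, add_comm _ pen, add_assoc]

/-- The penalty terms `D` and `E` are those of the one-stage identity for the transition kernels;
which of the two is the divergence from `ι` depends on the sign of `λ^S`, so that no subtraction
occurs. -/
theorem policyCost_add_expPathSum_eq [MeasurableSpace.CountablyGenerated U]
    (hπ : π ∈ P.policies) (hτ : τ ∈ P.transitions) {t : ℕ} (ht : t ≤ P.T) (μ : Measure X)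
    {D E : ℕ → X × U → ℝ≥0∞} (hD : ∀ k < P.T, Measurable (D k)) (hE : ∀ k < P.T, Measurable (E k))
    (hstep : ∀ k < P.T, ∀ z,
      ∫⁻ x', ENNReal.ofReal (P.c k z + P.V (k + 1) x') ∂(τ k z) + D k z
        = ENNReal.ofReal (P.Q k z) + E k z) :
    P.policyCost t μ π τ + P.expPathSum t μ π τ D 0
      = ∫⁻ x, ENNReal.ofReal (P.V t x) ∂μ + ENNReal.ofReal (1 / P.lamP) * P.policyGap t μ π τ
        + P.expPathSum t μ π τ E 0 := by
  set w := ENNReal.ofReal (1 / P.lamP)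
  set c : ℕ → X × U → ℝ≥0∞ := fun k z => ENNReal.ofReal (P.c k z)
  set pen : ℕ → X × U → ℝ≥0∞ := fun k z => klDiv (π k z.1) (P.ρ k z.1)
  set gap : ℕ → X × U → ℝ≥0∞ := fun k z => klDiv (π k z.1) (P.optPolicy k z.1)
  have hc (k : ℕ) (_ : k < P.T) : Measurable (c k) := (P.c_measurable k).ennreal_ofReal
  have hpen (k : ℕ) (hk : k < P.T) : Measurable (pen k) :=
    P.measurable_klDiv_policy hπ P.ρ_mem_policies hk
  have hgap (k : ℕ) (hk : k < P.T) : Measurable (gap k) :=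
    P.measurable_klDiv_policy hπ P.optPolicy_mem_policies hk
  have hcpen (k : ℕ) (hk : k < P.T) : Measurable ((c + w • pen) k) :=
    (hc k hk).add ((hpen k hk).const_mul w)
  have hwgap (k : ℕ) (hk : k < P.T) : Measurable ((w • gap) k) := (hgap k hk).const_mul w
  have hV (k : ℕ) : Measurable fun x => ENNReal.ofReal (P.V k x) :=
    (P.measurable_V k).ennreal_ofReal
  have hVT : (fun x => ENNReal.ofReal (P.V P.T x)) = fun x => ENNReal.ofReal (P.cT x) := by
    simp only [P.V_T]
  have hcost : P.expPathSum t μ π τ (c + w • pen + D) (fun x => ENNReal.ofReal (P.V P.T x))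
      = P.policyCost t μ π τ + P.expPathSum t μ π τ D 0 := by
    have hcT := P.cT_measurable.ennreal_ofReal
    rw [hVT, P.expPathSum_add ht hcpen hcT, P.expPathSum_add ht hc hcT,
      P.expPathSum_smul ht w hpen, policyCost_eq_expPathSum]
  have hgaps : P.expPathSum t μ π τ (w • gap + E) 0
      = w * P.policyGap t μ π τ + P.expPathSum t μ π τ E 0 := by
    rw [P.expPathSum_add ht hwgap measurable_zero, P.expPathSum_smul ht w hgap, policyGap]
  rw [add_assoc, ← hgaps, ← hcost]
  exact (P.lintegral_add_expPathSum_eq hπ hτ ht (fun k hk => (hcpen k hk).add (hD k hk))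
    (fun k hk => (hwgap k hk).add (hE k hk)) hV
    fun k hk x => P.V_add_lintegral_gap_eq hπ hτ hk (hstep k hk) x).symm

end Decomposition

section SaddlePoint

variable {π : ℕ → Kernel X U} {τ : ℕ → Kernel (X × U) X} {t : ℕ} (μ : Measure X)

theorem policyCost_add_expTransitionKL_eq_of_pos [MeasurableSpace.CountablyGenerated X]
    [MeasurableSpace.CountablyGenerated U] (hS : 0 < P.lamS) (hπ : π ∈ P.policies)
    (hτ : τ ∈ P.transitions) (ht : t ≤ P.T) :
    P.policyCost t μ π τ + ENNReal.ofReal (1 / P.lamS) * P.expTransitionKL t μ π τ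
      = ∫⁻ x, ENNReal.ofReal (P.V t x) ∂μ + ENNReal.ofReal (1 / P.lamP) * P.policyGap t μ π τ
        + ENNReal.ofReal (1 / P.lamS) * P.transitionGap t μ π τ := by
  have hi := hasExpMoments_of_pos hS
  have hpen (k : ℕ) (hk : k < P.T) := P.measurable_klDiv_transition hτ P.ι_mem_transitions hk
  have hgap (k : ℕ) (hk : k < P.T) :=
    P.measurable_klDiv_transition hτ hi.optTransition_mem_transitions hk
  rw [expTransitionKL_eq_expPathSum, transitionGap, ← P.expPathSum_smul ht _ hpen,
    ← P.expPathSum_smul ht _ hgap]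
  refine P.policyCost_add_expPathSum_eq hπ hτ ht μ (fun k hk => (hpen k hk).const_mul _)
    (fun k hk => (hgap k hk).const_mul _) fun k hk z => ?_
  have := hτ k hk
  simp only [Pi.smul_apply, smul_eq_mul, hi.optTransition_apply hk]
  exact lintegral_add_klDiv_eq_of_pos hS ((P.measurable_V (k + 1)).const_add _)
    (P.c_add_V_nonneg k z)

variable {P} in
theorem HasExpMoments.policyCost_add_transitionGap_eq_of_neg [MeasurableSpace.CountablyGenerated X]
    [MeasurableSpace.CountablyGenerated U] (hi : P.HasExpMoments) (hS : P.lamS < 0)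
    (hπ : π ∈ P.policies) (hτ : τ ∈ P.transitions) (ht : t ≤ P.T) :
    P.policyCost t μ π τ + ENNReal.ofReal (-(1 / P.lamS)) * P.transitionGap t μ π τ
      = ∫⁻ x, ENNReal.ofReal (P.V t x) ∂μ + ENNReal.ofReal (1 / P.lamP) * P.policyGap t μ π τ
        + ENNReal.ofReal (-(1 / P.lamS)) * P.expTransitionKL t μ π τ := by
  have hpen (k : ℕ) (hk : k < P.T) := P.measurable_klDiv_transition hτ P.ι_mem_transitions hk
  have hgap (k : ℕ) (hk : k < P.T) :=
    P.measurable_klDiv_transition hτ hi.optTransition_mem_transitions hk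
  rw [expTransitionKL_eq_expPathSum, transitionGap, ← P.expPathSum_smul ht _ hpen,
    ← P.expPathSum_smul ht _ hgap]
  refine P.policyCost_add_expPathSum_eq hπ hτ ht μ (fun k hk => (hgap k hk).const_mul _)
    (fun k hk => (hpen k hk).const_mul _) fun k hk z => ?_
  have := hτ k hk
  simp only [Pi.smul_apply, smul_eq_mul, hi.optTransition_apply hk]
  exact lintegral_add_klDiv_eq_of_neg hS ((P.measurable_V (k + 1)).const_add _)
    (P.c_add_V_nonneg k z) (hi k hk z)

variable [MeasurableSpace.CountablyGenerated X] [MeasurableSpace.CountablyGenerated U]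

theorem lintegral_V_le_objective_of_pos (hS : 0 < P.lamS) (hπ : π ∈ P.policies)
    (hτ : τ ∈ P.transitions) (ht : t ≤ P.T) :
    ((∫⁻ x, ENNReal.ofReal (P.V t x) ∂μ : ℝ≥0∞) : EReal) ≤ P.objective t μ π τ := by
  rw [objective_eq, coe_add_mul_coe_of_nonneg (one_div_pos.2 hS).le,
    P.policyCost_add_expTransitionKL_eq_of_pos μ hS hπ hτ ht,
    EReal.coe_ennreal_le_coe_ennreal_iff, add_assoc]
  exact le_self_add

namespace HasExpMoments

variable {P} (hi : P.HasExpMoments)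
include hi

theorem lintegral_V_le_objective_optTransition_of_neg (hS : P.lamS < 0) (hπ : π ∈ P.policies)
    (ht : t ≤ P.T) (hK : P.expTransitionKL t μ π P.optTransition ≠ ⊤) :
    ((∫⁻ x, ENNReal.ofReal (P.V t x) ∂μ : ℝ≥0∞) : EReal)
      ≤ P.objective t μ π P.optTransition := by
  have h := hi.policyCost_add_transitionGap_eq_of_neg μ hS hπ hi.optTransition_mem_transitions ht
  rw [hi.transitionGap_optTransition, mul_zero, add_zero] at h
  rw [objective_eq]
  exact le_coe_add_mul_of_neg (one_div_neg.2 hS) hK (h ▸ add_le_add_left le_self_add _)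

theorem objective_optPolicy_le_of_neg (hS : P.lamS < 0) (hτ : τ ∈ P.transitions) (ht : t ≤ P.T) :
    P.objective t μ P.optPolicy τ ≤ ((∫⁻ x, ENNReal.ofReal (P.V t x) ∂μ : ℝ≥0∞) : EReal) := by
  have h := hi.policyCost_add_transitionGap_eq_of_neg μ hS P.optPolicy_mem_policies hτ ht
  rw [policyGap_optPolicy, mul_zero, add_zero] at h
  rw [objective_eq]
  exact coe_add_mul_le_of_neg (one_div_neg.2 hS) (h ▸ le_self_add)

theorem objective_opt_eq (ht : t ≤ P.T)
    (hK : P.lamS < 0 → P.expTransitionKL t μ P.optPolicy P.optTransition ≠ ⊤) :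
    P.objective t μ P.optPolicy P.optTransition
      = ((∫⁻ x, ENNReal.ofReal (P.V t x) ∂μ : ℝ≥0∞) : EReal) := by
  have hπ := P.optPolicy_mem_policies
  have hτ := hi.optTransition_mem_transitions
  rcases P.lamS_ne_zero.lt_or_gt with hS | hS
  · exact le_antisymm (hi.objective_optPolicy_le_of_neg μ hS hτ ht)
      (hi.lintegral_V_le_objective_optTransition_of_neg μ hS hπ ht (hK hS))
  · rw [objective_eq, coe_add_mul_coe_of_nonneg (one_div_pos.2 hS).le,
      P.policyCost_add_expTransitionKL_eq_of_pos μ hS hπ hτ ht, policyGap_optPolicy,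
      hi.transitionGap_optTransition, mul_zero, mul_zero, add_zero, add_zero]

end HasExpMoments

end SaddlePoint

section BoundedCosts

variable {P} {M : ℝ} (hc : ∀ t z, P.c t z ≤ M) (hcT : ∀ x, P.cT x ≤ M)
include hc hcT

theorem valueAux_le (n t : ℕ) (x : X) : P.valueAux n t x ≤ (n + 1) * M := by
  induction n generalizing t x with
  | zero => simpa [valueAux] using hcT x
  | succ n ih =>
    have hmeas : Measurable fun p : (X × U) × X => P.c t p.1 + P.valueAux n (t + 1) p.2 :=
      ((P.c_measurable t).comp measurable_fst).add
        ((P.measurable_valueAux n (t + 1)).comp measurable_snd)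
    have hnonneg (z : X × U) (x' : X) : 0 ≤ P.c t z + P.valueAux n (t + 1) x' :=
      add_nonneg (P.c_nonneg t z) (P.valueAux_nonneg n (t + 1) x')
    refine entropicRisk_le_of_le P.lamP_pos.ne'
      ((measurable_entropicRisk hmeas P.lamS).comp measurable_prodMk_left)
      (fun u => entropicRisk_nonneg (hnonneg (x, u))) fun u => ?_
    refine entropicRisk_le_of_le P.lamS_ne_zero (hmeas.comp measurable_prodMk_left)
      (hnonneg (x, u)) fun x' => ?_
    simp only [Function.comp_apply]
    push_cast
    linarith [hc t (x, u), ih (t + 1) x']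

theorem c_add_V_le {t : ℕ} (ht : t < P.T) (z : X × U) (x : X) :
    P.c t z + P.V (t + 1) x ≤ (P.T + 1) * M := by
  have hM : 0 ≤ M := (P.cT_nonneg x).trans (hcT x)
  have hV : P.V (t + 1) x ≤ ((P.T - (t + 1) : ℕ) + 1) * M := valueAux_le hc hcT _ _ x
  have hcard : ((P.T - (t + 1) : ℕ) : ℝ) + 1 ≤ P.T := by exact_mod_cast (by omega)
  linarith [hc t z, mul_le_mul_of_nonneg_right hcard hM]

theorem hasExpMoments_of_bounded : P.HasExpMoments := fun t ht z =>
  integrable_exp_neg_mul_of_le ((P.measurable_V (t + 1)).const_add _) (P.c_add_V_nonneg t z)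
    (c_add_V_le hc hcT ht z) (integrable_const _)

theorem expTransitionKL_optTransition_ne_top_of_bounded (hS : P.lamS < 0)
    {π : ℕ → Kernel X U} (hπ : π ∈ P.policies) {t : ℕ} (ht : t ≤ P.T) (μ : Measure X)
    [IsFiniteMeasure μ] :
    P.expTransitionKL t μ π P.optTransition ≠ ⊤ := by
  have hi := hasExpMoments_of_bounded hc hcT
  set B : ℝ≥0∞ := ENNReal.ofReal (-P.lamS * ((P.T + 1) * M))
  have hstep (k : ℕ) (hk : k < P.T) (z : X × U) :
      klDiv (P.optTransition k z) (P.ι k z) ≤ B := by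
    rw [hi.optTransition_apply hk]
    exact klDiv_gibbsMeasure_self_le_of_neg hS ((P.measurable_V (k + 1)).const_add _)
      (P.c_add_V_nonneg k z) (c_add_V_le hc hcT hk z)
  have hpath (ξ : Trajectory X U (P.T - t)) :
      P.transitionKL P.optTransition t ξ ≤ (P.T - t : ℕ) * B := by
    refine (Finset.sum_le_card_nsmul _ _ B fun k _ => hstep _ (by omega) _).trans_eq ?_
    simp
  have hmarkov : IsMarkovKernel (trajKernel π P.optTransition (P.T - t) t) :=
    isMarkovKernel_trajKernel hπ hi.optTransition_mem_transitions (by omega)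
  have hlaw : IsFiniteMeasure (P.law π P.optTransition t μ) := by unfold law; infer_instance
  refine ne_top_of_le_ne_top ?_ (lintegral_mono hpath)
  rw [lintegral_const]
  exact ENNReal.mul_ne_top (ENNReal.mul_ne_top (ENNReal.natCast_ne_top _) ENNReal.ofReal_ne_top)
    (measure_ne_top _ _)

end BoundedCosts

section Truncation

/-- The control problem with all costs truncated at `m`. Its tilted kernels have finite divergence
from `ι`, and its value functions increase to those of `P`. -/
def truncate (m : ℕ) : KLControl X U :=
  { P with
    c := fun t z => min (P.c t z) m
    c_measurable := fun t => (P.c_measurable t).min measurable_const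
    c_nonneg := fun t z => le_min (P.c_nonneg t z) m.cast_nonneg
    cT := fun x => min (P.cT x) m
    cT_measurable := P.cT_measurable.min measurable_const
    cT_nonneg := fun x => le_min (P.cT_nonneg x) m.cast_nonneg }

theorem hasExpMoments_truncate (m : ℕ) : (P.truncate m).HasExpMoments :=
  hasExpMoments_of_bounded (fun _ _ => min_le_right _ _) fun _ => min_le_right _ _

theorem expTransitionKL_truncate_ne_top (hS : P.lamS < 0) {π : ℕ → Kernel X U}
    (hπ : π ∈ P.policies) {t : ℕ} (ht : t ≤ P.T) (μ : Measure X) [IsFiniteMeasure μ] (m : ℕ) :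
    P.expTransitionKL t μ π (P.truncate m).optTransition ≠ ⊤ :=
  expTransitionKL_optTransition_ne_top_of_bounded (P := P.truncate m)
    (fun _ _ => min_le_right _ _) (fun _ => min_le_right _ _) hS hπ ht μ

theorem objective_truncate_le (m t : ℕ) (μ : Measure X) (π : ℕ → Kernel X U)
    (τ : ℕ → Kernel (X × U) X) : (P.truncate m).objective t μ π τ ≤ P.objective t μ π τ := by
  have hcost (ξ : Trajectory X U (P.T - t)) : (P.truncate m).cumCost t ξ ≤ P.cumCost t ξ :=
    add_le_add (Finset.sum_le_sum fun _ _ => ENNReal.ofReal_le_ofReal (min_le_left _ _))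
      (ENNReal.ofReal_le_ofReal (min_le_left _ _))
  exact add_le_add_left (add_le_add_left
    (EReal.coe_ennreal_le_coe_ennreal_iff.2 (lintegral_mono hcost)) _) _

variable {P}

theorem HasExpMoments.Q_truncate_le_of_V_le (hi : P.HasExpMoments) {m t : ℕ} (ht : t < P.T)
    (hV : ∀ x, (P.truncate m).V (t + 1) x ≤ P.V (t + 1) x) (z : X × U) :
    (P.truncate m).Q t z ≤ P.Q t z :=
  entropicRisk_mono (((P.truncate m).measurable_V (t + 1)).const_add _)
    ((P.truncate m).c_add_V_nonneg t z) (fun x => add_le_add (min_le_left _ _) (hV x)) (hi t ht z)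

theorem HasExpMoments.V_truncate_le (hi : P.HasExpMoments) (m : ℕ) {t : ℕ} (ht : t ≤ P.T)
    (x : X) : (P.truncate m).V t x ≤ P.V t x := by
  induction ht using Nat.decreasingInduction generalizing x with
  | self => exact ((P.truncate m).V_T x).trans_le ((min_le_left _ _).trans_eq (P.V_T x).symm)
  | of_succ t ht ih =>
    rw [(P.truncate m).V_of_lt ht, P.V_of_lt ht]
    exact entropicRisk_mono (((P.truncate m).measurable_Q t).comp measurable_prodMk_left)
      (fun u => (P.truncate m).Q_nonneg t (x, u))
      (fun u => hi.Q_truncate_le_of_V_le ht ih (x, u)) (P.integrable_exp_Q t x)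

theorem HasExpMoments.tendsto_V_truncate (hi : P.HasExpMoments) {t : ℕ} (ht : t ≤ P.T) (x : X) :
    Filter.Tendsto (fun m => (P.truncate m).V t x) Filter.atTop (nhds (P.V t x)) := by
  induction ht using Nat.decreasingInduction generalizing x with
  | self =>
    rw [P.V_T]
    exact (tendsto_min_natCast (P.cT x)).congr fun m => ((P.truncate m).V_T x).symm
  | of_succ t ht ih =>
    have hV (m : ℕ) (x' : X) := hi.V_truncate_le m ht x'
    have hQ (z : X × U) :
        Filter.Tendsto (fun m => (P.truncate m).Q t z) Filter.atTop (nhds (P.Q t z)) :=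
      tendsto_entropicRisk (fun m => ((P.truncate m).measurable_V (t + 1)).const_add _)
        (fun m => (P.truncate m).c_add_V_nonneg t z)
        (fun m x' => add_le_add (min_le_left _ _) (hV m x')) (hi t ht z)
        fun x' => (tendsto_min_natCast (P.c t z)).add (ih x')
    rw [P.V_of_lt ht]
    refine Filter.Tendsto.congr (fun m => ((P.truncate m).V_of_lt ht x).symm) ?_
    exact tendsto_entropicRisk
      (fun m => ((P.truncate m).measurable_Q t).comp measurable_prodMk_left)
      (fun m u => (P.truncate m).Q_nonneg t (x, u))
      (fun m u => hi.Q_truncate_le_of_V_le ht (hV m) (x, u))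
      (P.integrable_exp_Q t x) fun u => hQ (x, u)

end Truncation

section Values

variable [MeasurableSpace.CountablyGenerated X] [MeasurableSpace.CountablyGenerated U]
  {π : ℕ → Kernel X U} {t : ℕ}

theorem lintegral_V_truncate_le_innerValue_of_neg (hS : P.lamS < 0) (hπ : π ∈ P.policies)
    (ht : t ≤ P.T) (μ : Measure X) [IsFiniteMeasure μ] (m : ℕ) :
    ((∫⁻ x, ENNReal.ofReal ((P.truncate m).V t x) ∂μ : ℝ≥0∞) : EReal) ≤ P.innerValue t μ π := by
  have hi := P.hasExpMoments_truncate m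
  have hobj := (hi.lintegral_V_le_objective_optTransition_of_neg μ hS hπ ht
    (P.expTransitionKL_truncate_ne_top hS hπ ht μ m)).trans (P.objective_truncate_le m t μ π _)
  unfold innerValue optOver
  rw [if_neg hS.not_gt]
  exact le_iSup₂_of_le _ hi.optTransition_mem_transitions hobj

namespace HasExpMoments

variable {P} (hi : P.HasExpMoments) (ht : t ≤ P.T) (μ : Measure X)
include hi ht

theorem innerValue_optPolicy_le :
    P.innerValue t μ P.optPolicy ≤ ((∫⁻ x, ENNReal.ofReal (P.V t x) ∂μ : ℝ≥0∞) : EReal) := by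
  unfold innerValue optOver
  rcases P.lamS_ne_zero.lt_or_gt with hS | hS
  · rw [if_neg hS.not_gt]
    exact iSup₂_le fun τ hτ => hi.objective_optPolicy_le_of_neg μ hS hτ ht
  · rw [if_pos hS]
    exact (iInf₂_le _ hi.optTransition_mem_transitions).trans
      (hi.objective_opt_eq μ ht fun hneg => absurd hneg hS.not_gt).le

variable [IsFiniteMeasure μ]

theorem lintegral_V_le_innerValue (hπ : π ∈ P.policies) :
    ((∫⁻ x, ENNReal.ofReal (P.V t x) ∂μ : ℝ≥0∞) : EReal) ≤ P.innerValue t μ π := by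
  rcases P.lamS_ne_zero.lt_or_gt with hS | hS
  · have hlim (x : X) : ENNReal.ofReal (P.V t x)
        = Filter.liminf (fun m => ENNReal.ofReal ((P.truncate m).V t x)) Filter.atTop :=
      (ENNReal.tendsto_ofReal (hi.tendsto_V_truncate ht x)).liminf_eq.symm
    have hFatou := lintegral_liminf_le (μ := μ) (u := Filter.atTop)
      fun m => ((P.truncate m).measurable_V t).ennreal_ofReal
    simp only [hlim]
    exact (EReal.coe_ennreal_le_coe_ennreal_iff.2 hFatou).trans
      (coe_liminf_le (P.lintegral_V_truncate_le_innerValue_of_neg hS hπ ht μ))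
  · unfold innerValue optOver
    rw [if_pos hS]
    exact le_iInf₂ fun τ hτ => P.lintegral_V_le_objective_of_pos μ hS hπ hτ ht

theorem innerValue_optPolicy_eq :
    P.innerValue t μ P.optPolicy = ((∫⁻ x, ENNReal.ofReal (P.V t x) ∂μ : ℝ≥0∞) : EReal) :=
  le_antisymm (hi.innerValue_optPolicy_le ht μ)
    (hi.lintegral_V_le_innerValue ht μ P.optPolicy_mem_policies)

theorem optimalValue_eq :
    P.optimalValue t μ = ((∫⁻ x, ENNReal.ofReal (P.V t x) ∂μ : ℝ≥0∞) : EReal) :=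
  le_antisymm ((iInf₂_le _ P.optPolicy_mem_policies).trans (hi.innerValue_optPolicy_le ht μ))
    (le_iInf₂ fun _ hπ => hi.lintegral_V_le_innerValue ht μ hπ)

end HasExpMoments

end Values

theorem coe_lintegral_dirac_V (t : ℕ) (x : X) :
    ((∫⁻ y, ENNReal.ofReal (P.V t y) ∂(Measure.dirac x) : ℝ≥0∞) : EReal)
      = ((P.V t x : ℝ) : EReal) := by
  rw [lintegral_dirac' _ (P.measurable_V t).ennreal_ofReal,
    coe_ennreal_ofReal_of_nonneg (P.V_nonneg t x)]

end KLControl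

end

theorem mainTheorem1 {X U : Type*} [MeasurableSpace X] [MeasurableSpace U]
    [MeasurableSpace.CountablyGenerated X] [MeasurableSpace.CountablyGenerated U]
    (P : KLControl X U)
    -- finiteness of the exponential moments in the risk-averse case
    (hexp : P.lamS < 0 → ∀ t < P.T, ∀ z : X × U,
      Integrable (fun x' => Real.exp (-P.lamS * (P.c t z + P.V (t + 1) x'))) (P.ι t z)) :
    -- regularity of the recursion and admissibility of the tilted kernels
    (∀ t ≤ P.T, Measurable (P.V t) ∧ ∀ x, 0 ≤ P.V t x) ∧
    (∀ t < P.T, Measurable (P.Q t) ∧ ∀ z, 0 ≤ P.Q t z) ∧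
    P.optPolicy ∈ P.policies ∧ P.optTransition ∈ P.transitions ∧
    -- terminal condition
    (∀ x, P.V P.T x = P.cT x) ∧
    -- recursion for `V_t` and the optimal policy
    (∀ t < P.T, ∀ x,
      P.V t x = entropicRisk P.lamP (P.ρ t x) (fun u => P.Q t (x, u)) ∧
      IsLeast (klStage P.lamP (P.ρ t x) (fun u => P.Q t (x, u)) '' probMeasures U)
        ((P.V t x : ℝ) : EReal) ∧
      (∀ ν ∈ probMeasures U,
        klStage P.lamP (P.ρ t x) (fun u => P.Q t (x, u)) ν = ((P.V t x : ℝ) : EReal)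
          ↔ ν = P.optPolicy t x) ∧
      P.optPolicy t x = (P.ρ t x).withDensity fun u =>
        ENNReal.ofReal (Real.exp (-P.lamP * P.Q t (x, u)) / Real.exp (-P.lamP * P.V t x))) ∧
    -- recursion for `Q_t` and the optimal transition kernel
    (∀ t < P.T, ∀ z : X × U,
      P.Q t z = entropicRisk P.lamS (P.ι t z) (fun x' => P.c t z + P.V (t + 1) x') ∧
      optOver P.lamS (probMeasures X)
        (klStage P.lamS (P.ι t z) (fun x' => P.c t z + P.V (t + 1) x'))
          = ((P.Q t z : ℝ) : EReal) ∧
      (∀ ν ∈ probMeasures X,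
        klStage P.lamS (P.ι t z) (fun x' => P.c t z + P.V (t + 1) x') ν
          = ((P.Q t z : ℝ) : EReal) → ν = P.optTransition t z) ∧
      ((P.lamS < 0 → klDiv (P.optTransition t z) (P.ι t z) ≠ ⊤) →
        klStage P.lamS (P.ι t z) (fun x' => P.c t z + P.V (t + 1) x') (P.optTransition t z)
          = ((P.Q t z : ℝ) : EReal) ∧
        ∀ ν, IsArgOpt P.lamS (probMeasures X) (klStage P.lamS (P.ι t z) (P.V (t + 1))) ν
          ↔ ν = P.optTransition t z) ∧
      P.optTransition t z = (P.ι t z).withDensity fun x' =>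
        ENNReal.ofReal
          (Real.exp (-P.lamS * (P.c t z + P.V (t + 1) x')) / Real.exp (-P.lamS * P.Q t z))) ∧
    -- `V_t(x)` is the optimal cost-to-go, and the tilted policies and kernels are optimal
    (∀ t ≤ P.T, ∀ x,
      P.optimalValue t (Measure.dirac x) = ((P.V t x : ℝ) : EReal) ∧
      P.innerValue t (Measure.dirac x) P.optPolicy = ((P.V t x : ℝ) : EReal) ∧
      ((P.lamS < 0 →
          P.expTransitionKL t (Measure.dirac x) P.optPolicy P.optTransition ≠ ⊤) →
        P.objective t (Measure.dirac x) P.optPolicy P.optTransition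
          = ((P.V t x : ℝ) : EReal))) ∧
    -- the full problem, started from the initial law
    (P.optimalValue 0 P.init = ((∫⁻ x, ENNReal.ofReal (P.V 0 x) ∂P.init : ℝ≥0∞) : EReal) ∧
      P.innerValue 0 P.init P.optPolicy = P.optimalValue 0 P.init ∧
      ((P.lamS < 0 → P.expTransitionKL 0 P.init P.optPolicy P.optTransition ≠ ⊤) →
        P.objective 0 P.init P.optPolicy P.optTransition = P.optimalValue 0 P.init)) := by
  have hi : P.HasExpMoments := P.lamS_ne_zero.lt_or_gt.elim hexp KLControl.hasExpMoments_of_pos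
  refine ⟨fun t _ => ⟨P.measurable_V t, P.V_nonneg t⟩, fun t _ => ⟨P.measurable_Q t, P.Q_nonneg t⟩,
    P.optPolicy_mem_policies, hi.optTransition_mem_transitions, P.V_T,
    fun t ht x => ⟨P.V_of_lt ht x, P.isLeast_klStage_Q ht x,
      fun ν hν => P.klStage_Q_eq_V_iff ht x hν, P.optPolicy_eq_withDensity ht x⟩,
    fun t ht z => ⟨rfl, hi.optOver_klStage_c_add_V ht z,
      fun ν hν => hi.eq_optTransition_of_klStage_eq ht z hν,
      fun hK => ⟨hi.klStage_optTransition ht z hK, hi.isArgOpt_klStage_V_iff ht z hK⟩,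
      hi.optTransition_eq_withDensity ht z⟩,
    fun t ht x => ?_, ?_⟩
  · rw [← P.coe_lintegral_dirac_V]
    exact ⟨hi.optimalValue_eq ht _, hi.innerValue_optPolicy_eq ht _, hi.objective_opt_eq _ ht⟩
  · rw [hi.optimalValue_eq (Nat.zero_le _)]
    exact ⟨rfl, hi.innerValue_optPolicy_eq (Nat.zero_le _) _,
      hi.objective_opt_eq _ (Nat.zero_le _)⟩
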